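/- Let $f$ be a field of characteristic $0$ and let $W_1=\mathrm{Der}_f(f[[t]])$ be the Lie algebra of formal vector fields on a line, with $l_i=t^{i+1}\frac{d}{dt}$. For $n\ge 0$ let $L_n\subset W_1$ be the subalgebra of the fields $\sum_{i\ge n}a_il_i$, and for $m\le n$ put $L_{mn}=L_m/L_n$, with basis $l_m,\dots,l_{n-1}$ (classes mod $L_n$). Let $G_0$ be the group of automorphisms of $f((t))$ over $f$, let $G_n=\{g\in G_0 : g(t)=t+o(t^n)\}$ for $n\geq 1$, and for $1\le m\le n$ put $G_{mn}=G_m/G_n$. For $m\geq 1$, $G_m$ acts on $L_m$, and $G_{mn}$ on $L_{mn}$, by $D\mapsto gDg^{-1}$. The dual actions on $L_{mn}^*$ and on $L_m^*:=\bigcup_{n\ge m}L_{mn}^*$ (the linear forms on $L_m$ vanishing on some $L_n$) are called co-adjoint; here $L_{mn}^*\subset L_{mi}^*\subset L_m^*$ for $n\le i$ through the projections $L_m\to L_{mi}\to L_{mn}$. The $l_i$ serve as coordinates on $L_{mn}^*$. An orbit $O$ of the co-adjoint representation of $G_{mn}$ is called an orbit in general position if, for every $j$ with $m\le j\le n$,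 the image of $O$ in $L_{jn}^*$ (restriction of linear forms to the ideal $L_{jn}\subset L_{mn}$) has the largest dimension among the images in $L_{jn}^*$ of all orbits of $G_{mn}$ in $L_{mn}^*$; the dimension of a set is that of its Zariski closure. For $m\ge0$ and $k\ge1$ let $P_{mk}(x_0,\dots,x_{m+k})$ be the polynomials over $f$ defined by $$\sum_{k=1}^{\infty}P_{mk}(x_0,\dots,x_{m+k})z^k=\frac{\sqrt{\sum_{k=0}^{\infty}x_kx_0^{k-1}z^k}-\sqrt{\sum_{k=0}^{m}x_kx_0^{k-1}z^k}}{x_0^mz^m},$$ where the square roots are the power series in $z$ with constant term $1$. **Theorem.** Let $m\ge 0$ and $n\geq m$. 1. If $n\le 2m+2$, all orbits of the co-adjoint representation of $G_{m+1,n+1}$ in $L_{m+1,n+1}^*$ are points, every point is an orbit, and all orbits are in general position. 2. If $n>2m+2$ is odd, the orbits in general position of $G_{m+1,n+1}$ in $L_{m+1,n+1}^*$ are parametrized bijectively by $c_0\in f\setminus\{0\}$, $c_1,\dots,c_m\in f$: they are the affine planes, of dimension $n-2m-1$, given by the equations $l_n=c_0,\ l_{n-1}=c_1,\dots,l_{n-m}=c_m$.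 3. If $n>2m+2$ is even, they are parametrized bijectively by $c_0\in f\setminus\{0\}$, $c_1,\dots,c_{m+1}\in f$: they are the (irreducible) affine varieties, of dimension $n-2m-2$, given by the equations $l_n=c_0,\ l_{n-1}=c_1,\dots,l_{n-m}=c_m,\ P_{mk}(l_n,l_{n-1},\dots,l_{n/2})=c_{m+1}$ with $k=\frac n2-m$. 4. Each orbit in general position of $G_{m+1,n+1}$ in $L_{m+1,n+1}^*$ is an orbit of $G_{m+1,i+1}$ in $L_{m+1,i+1}^*$ for all $i\ge n$, as well as an orbit of $G_{m+1}$ in $L_{m+1}^*$. 5. For $i\ge m$, each orbit of $G_{m+1,i+1}$ in $L_{m+1,i+1}^*$ is an orbit in general position of $G_{m+1,n+1}$ in $L_{m+1,n+1}^*$ for some $n$ with $\min(2m+2,i)\le n\le i$. 6. Each orbit of $G_{m+1}$ in $L_{m+1}^*$ is an orbit in general position of $G_{m+1,n+1}$ in $L_{m+1,n+1}^*$ for some $n\ge 2m+2$. -/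

import Mathlib

open scoped PowerSeries LaurentSeries

noncomputable section

namespace FormalLine

open PowerSeries (X C constantCoeff coeff binomialSeries)

section Field

variable (f : Type*) [Field f]

/-! ### The Lie algebras of formal vector fields on a line -/

/-- The Lie algebra of formal vector fields on a line: all `f`-linear derivations of `f⟦t⟧`. -/
abbrev W₁ : Type _ := Derivation f f⟦X⟧ f⟦X⟧

/-- The vector field `l_i = t ^ (i + 1) * d/dt`, for `i ≥ 0`. -/
def l (i : ℕ) : W₁ f := (X ^ (i + 1) : f⟦X⟧) • PowerSeries.derivative f

variable {f}

theorem deriv_apply (D : W₁ f) (h : f⟦X⟧) : D h = PowerSeries.derivative f h * D X := by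
  have key : ∀ (N : ℕ) (E : W₁ f) (_ : E X = 0) (h : f⟦X⟧), (X : f⟦X⟧) ^ N ∣ E h := by
    intro N E hE
    induction N with
    | zero => intro h; simp
    | succ N ih =>
      intro h
      obtain ⟨q, hq⟩ : ∃ q : f⟦X⟧, h = X * q + C (constantCoeff h) := by
        have : (X : f⟦X⟧) ∣ h - C (constantCoeff h) := by
          rw [PowerSeries.X_dvd_iff]; simp
        obtain ⟨q, hq⟩ := this
        exact ⟨q, by rw [← hq]; ring⟩
      have hC : E (C (constantCoeff h)) = 0 := E.map_algebraMap (constantCoeff h)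
      rw [hq, map_add, hC, Derivation.leibniz, hE, smul_zero, add_zero, add_zero, smul_eq_mul,
        pow_succ']
      exact mul_dvd_mul_left _ (ih q)
  have h0 : ∀ N : ℕ, (X : f⟦X⟧) ^ N ∣ (D - (D X) • PowerSeries.derivative f) h := fun N =>
    key N _ (by simp) h
  have : (D - (D X) • PowerSeries.derivative f) h = 0 := by
    ext k
    exact (PowerSeries.X_pow_dvd_iff.1 (h0 (k + 1))) k (Nat.lt_succ_self k)
  rw [Derivation.sub_apply, sub_eq_zero, Derivation.smul_apply, smul_eq_mul] at this
  rw [this, mul_comm]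

theorem deriv_X_pow_mul {n : ℕ} (D : W₁ f) (hD : (X : f⟦X⟧) ∣ D X) (q : f⟦X⟧) :
    (X : f⟦X⟧) ^ n ∣ D (X ^ n * q) := by
  rw [Derivation.leibniz, Derivation.leibniz_pow]
  refine dvd_add (Dvd.intro _ rfl) ?_
  rcases n with _ | n
  · simp
  · obtain ⟨r, hr⟩ := hD
    rw [hr]
    refine ⟨((n + 1 : ℕ) : f⟦X⟧) * (q * r), ?_⟩
    simp only [smul_eq_mul, nsmul_eq_mul, Nat.add_sub_cancel]
    ring

variable (f)

/-- `L_n`, for `n ≥ 0`: the vector fields `∑ a_i l_i` with `a_i = 0` for `i < n`. -/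
def L (n : ℕ) : LieSubalgebra f (W₁ f) where
  carrier := {D | (X : f⟦X⟧) ^ (n + 1) ∣ D X}
  add_mem' ha hb := dvd_add ha hb
  zero_mem' := dvd_zero _
  smul_mem' c D hD := by
    obtain ⟨q, hq⟩ := hD
    exact ⟨c • q, by simp [hq]⟩
  lie_mem' {D E} hD hE := by
    have hD' : (X : f⟦X⟧) ^ (n + 1) ∣ D X := hD
    have hE' : (X : f⟦X⟧) ^ (n + 1) ∣ E X := hE
    change (X : f⟦X⟧) ^ (n + 1) ∣ ⁅D, E⁆ X
    have hX : (X : f⟦X⟧) ∣ X ^ (n + 1) := dvd_pow_self _ (Nat.succ_ne_zero n)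
    rw [Derivation.commutator_apply]
    obtain ⟨p, hp⟩ := hD'
    obtain ⟨q, hq⟩ := hE'
    exact dvd_sub (by rw [hq]; exact deriv_X_pow_mul D (hX.trans hD) q)
      (by rw [hp]; exact deriv_X_pow_mul E (hX.trans hE) p)

variable {f}

theorem mem_L {n : ℕ} {D : W₁ f} : D ∈ L f n ↔ (X : f⟦X⟧) ^ (n + 1) ∣ D X := Iff.rfl

theorem L_antitone {m n : ℕ} (h : m ≤ n) {D : W₁ f} (hD : D ∈ L f n) : D ∈ L f m :=
  (pow_dvd_pow _ (Nat.succ_le_succ h)).trans hD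

theorem X_dvd_of_mem_L {n : ℕ} {D : W₁ f} (hD : D ∈ L f n) : (X : f⟦X⟧) ∣ D X :=
  (dvd_pow_self _ (Nat.succ_ne_zero n)).trans hD

theorem l_mem {m i : ℕ} (h : m ≤ i) : l f i ∈ L f m := by
  rw [mem_L]
  simpa [l] using pow_dvd_pow (X : f⟦X⟧) (Nat.succ_le_succ h)

variable (f)

/-- `L_n` as an ideal of `L_m`, for `0 ≤ m ≤ n`. -/
def LIdeal (m n : ℕ) : LieIdeal f (L f m) where
  carrier := {D | (D : W₁ f) ∈ L f n}
  add_mem' {a b} ha hb := (L f n).add_mem (x := (a : W₁ f)) (y := (b : W₁ f)) ha hb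
  zero_mem' := (L f n).zero_mem
  smul_mem' c _ hD := (L f n).smul_mem c hD
  lie_mem {D E} hE := by
    change (X : f⟦X⟧) ^ (n + 1) ∣ ⁅(D : W₁ f), (E : W₁ f)⁆ X
    have hE' : (X : f⟦X⟧) ^ (n + 1) ∣ (E : W₁ f) X := hE
    rw [Derivation.commutator_apply]
    refine dvd_sub ?_ ?_
    · obtain ⟨q, hq⟩ := hE'
      rw [hq]
      exact deriv_X_pow_mul _ (X_dvd_of_mem_L D.2) q
    · rw [deriv_apply]
      exact hE'.mul_left _

/-- The Lie algebra `L_{mn} = L_m / L_n`. -/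
abbrev Lq (m n : ℕ) : Type _ := L f m ⧸ LIdeal f m n

/-- The element `l_i + L_n` of `L_{mn}`, for `i ≥ m` (and `0` otherwise). -/
def lq (m n i : ℕ) : Lq f m n :=
  if h : m ≤ i then LieSubmodule.Quotient.mk ⟨l f i, l_mem h⟩ else 0

/-! ### The groups of automorphisms -/

/-- The group of all automorphisms of the field `f((t))` over `f`. -/
abbrev G₀ : Type _ := f⸨X⸩ ≃ₐ[f] f⸨X⸩

variable {f}

theorem exists_root [CharZero f] {h : f⟦X⟧} (hh : constantCoeff h = 0) {n : ℕ} (hn : n ≠ 0) :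
    ∃ y : f⟦X⟧, y ^ n = 1 + h := by
  have hs : PowerSeries.HasSubst h := PowerSeries.HasSubst.of_constantCoeff_zero' hh
  have hpow : ∀ (r : ℚ) (k : ℕ), binomialSeries f r ^ k = binomialSeries f (k * r) := by
    intro r k
    induction k with
    | zero => simp
    | succ k ih =>
      rw [pow_succ, ih, ← PowerSeries.binomialSeries_add]
      congr 1
      push_cast
      ring
  refine ⟨(binomialSeries f (1 / n : ℚ)).subst h, ?_⟩
  rw [← PowerSeries.subst_pow hs, hpow, mul_one_div_cancel (by exact_mod_cast hn)]
  have h1 : binomialSeries f (1 : ℚ) = 1 + X := by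
    simpa using PowerSeries.binomialSeries_nat (R := ℚ) (A := f) 1
  rw [h1, ← PowerSeries.coe_substAlgHom hs, map_add, map_one, PowerSeries.coe_substAlgHom hs,
    PowerSeries.subst_X hs]

/-- Automorphisms of `f((t))` over `f` preserve `f⟦t⟧`. -/
theorem exists_map_powerSeries [CharZero f] (g : G₀ f) (h : f⟦X⟧) :
    ∃ k : f⟦X⟧, HahnSeries.ofPowerSeries ℤ f k = g (HahnSeries.ofPowerSeries ℤ f h) := by
  set ι := HahnSeries.ofPowerSeries ℤ f with hι
  have hCC : ∀ c : f, ι (C c) = algebraMap f f⸨X⸩ c := by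
    intro c
    rw [HahnSeries.algebraMap_apply']
    rfl
  have main : ∀ h : f⟦X⟧, constantCoeff h = 0 → ∃ k : f⟦X⟧, ι k = g (ι h) := by
    intro h hh
    have hord : (g (ι (1 + h))).order = 0 := by
      by_contra hne
      obtain ⟨y, hy⟩ := exists_root hh
        (n := (g (ι (1 + h))).order.natAbs + 1) (Nat.succ_ne_zero _)
      have h2 : (g (ι (1 + h))).order
          = ((g (ι (1 + h))).order.natAbs + 1) • (g (ι y)).order := by
        conv_lhs => rw [← hy, map_pow, map_pow, HahnSeries.order_pow]
      have h3 : (((g (ι (1 + h))).order.natAbs + 1 : ℕ) : ℤ) ∣ (g (ι (1 + h))).order := by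
        exact ⟨_, by rw [← nsmul_eq_mul]; exact h2⟩
      have h4 := Int.le_of_dvd (by simpa using hne : (0 : ℤ) < |(g (ι (1 + h))).order|)
        ((dvd_abs _ _).2 h3)
      rw [Int.abs_eq_natAbs] at h4
      omega
    refine ⟨(g (ι (1 + h))).powerSeriesPart - 1, ?_⟩
    rw [map_sub, map_one, hι, LaurentSeries.ofPowerSeries_powerSeriesPart, ← hι, hord]
    simp
  obtain ⟨k, hk⟩ := main (h - C (constantCoeff h)) (by simp)
  refine ⟨k + C (constantCoeff h), ?_⟩
  rw [map_add, hk, hCC, map_sub, map_sub, hCC, AlgEquiv.commutes]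
  ring

/-- The restriction of an automorphism of `f((t))` to `f⟦t⟧`. -/
def resFun [CharZero f] (g : G₀ f) (h : f⟦X⟧) : f⟦X⟧ := (exists_map_powerSeries g h).choose

theorem coe_resFun [CharZero f] (g : G₀ f) (h : f⟦X⟧) :
    HahnSeries.ofPowerSeries ℤ f (resFun g h) = g (HahnSeries.ofPowerSeries ℤ f h) :=
  (exists_map_powerSeries g h).choose_spec

theorem ofPS_inj {a b : f⟦X⟧}
    (h : HahnSeries.ofPowerSeries ℤ f a = HahnSeries.ofPowerSeries ℤ f b) : a = b :=
  HahnSeries.ofPowerSeries_injective h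

variable (f)

/-- The restriction to `f⟦t⟧` of the automorphisms of `f((t))`. -/
def res [CharZero f] : G₀ f →* (f⟦X⟧ ≃ₐ[f] f⟦X⟧) where
  toFun g :=
    { toFun := resFun g
      invFun := resFun g⁻¹
      left_inv := fun h => ofPS_inj (by
        rw [coe_resFun, coe_resFun, ← AlgEquiv.mul_apply, inv_mul_cancel, AlgEquiv.one_apply])
      right_inv := fun h => ofPS_inj (by
        rw [coe_resFun, coe_resFun, ← AlgEquiv.mul_apply, mul_inv_cancel, AlgEquiv.one_apply])
      map_mul' := fun a b => ofPS_inj (by simp only [coe_resFun, map_mul])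
      map_add' := fun a b => ofPS_inj (by simp only [coe_resFun, map_add])
      commutes' := fun c => ofPS_inj (by
        have : HahnSeries.ofPowerSeries ℤ f (algebraMap f f⟦X⟧ c) = algebraMap f f⸨X⸩ c := by
          rw [HahnSeries.algebraMap_apply']
        rw [coe_resFun, this, AlgEquiv.commutes]) }
  map_one' := by
    ext1 h
    exact ofPS_inj (coe_resFun 1 h)
  map_mul' g₁ g₂ := by
    ext1 h
    refine ofPS_inj ?_
    change HahnSeries.ofPowerSeries ℤ f (resFun (g₁ * g₂) h) =
      HahnSeries.ofPowerSeries ℤ f (resFun g₁ (resFun g₂ h))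
    rw [coe_resFun, coe_resFun, coe_resFun, AlgEquiv.mul_apply]

variable {f}

theorem coe_res [CharZero f] (g : G₀ f) (h : f⟦X⟧) :
    HahnSeries.ofPowerSeries ℤ f (res f g h) = g (HahnSeries.ofPowerSeries ℤ f h) :=
  coe_resFun g h

theorem X_dvd_res_X [CharZero f] (g : G₀ f) : (X : f⟦X⟧) ∣ res f g X := by
  rw [PowerSeries.X_dvd_iff]
  by_contra h
  have h1 : IsUnit (res f g X) := PowerSeries.isUnit_iff_constantCoeff.2 (isUnit_iff_ne_zero.2 h)
  have h2 : IsUnit (X : f⟦X⟧) := (MulEquiv.isUnit_map (res f g)).1 h1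
  exact PowerSeries.X_prime.not_isUnit h2

theorem X_pow_dvd_res [CharZero f] (g : G₀ f) {n : ℕ} {h : f⟦X⟧} (hh : (X : f⟦X⟧) ^ n ∣ h) :
    (X : f⟦X⟧) ^ n ∣ res f g h := by
  have h1 : (res f g X) ^ n ∣ res f g h := by
    rw [← map_pow]; exact map_dvd _ hh
  exact (pow_dvd_pow_of_dvd (X_dvd_res_X g) n).trans h1

variable (f)

/-- For `n ≥ 0`, the group `G_n` of the automorphisms `g` of `f((t))` over `f` such that
`g(t) = t + o(t ^ n)` (which is no condition for `n = 0`). -/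
def G [CharZero f] (n : ℕ) : Subgroup (G₀ f) where
  carrier := {g | ∃ h : f⟦X⟧, g (HahnSeries.ofPowerSeries ℤ f X) =
    HahnSeries.ofPowerSeries ℤ f X + HahnSeries.ofPowerSeries ℤ f (X ^ (n + 1) * h)}
  one_mem' := ⟨0, by simp⟩
  mul_mem' {g₁ g₂} h₁ h₂ := by
    obtain ⟨a, ha⟩ := h₁
    obtain ⟨b, hb⟩ := h₂
    obtain ⟨c, hc⟩ := X_pow_dvd_res g₁ (Dvd.intro b rfl : (X : f⟦X⟧) ^ (n + 1) ∣ X ^ (n + 1) * b)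
    refine ⟨a + c, ?_⟩
    rw [AlgEquiv.mul_apply, hb, map_add, ha, ← coe_res, hc, ← map_add, ← map_add, ← map_add]
    congr 1
    ring
  inv_mem' {g} h := by
    obtain ⟨a, ha⟩ := h
    obtain ⟨c, hc⟩ := X_pow_dvd_res g⁻¹ (Dvd.intro a rfl : (X : f⟦X⟧) ^ (n + 1) ∣ X ^ (n + 1) * a)
    refine ⟨-c, ?_⟩
    have h1 : g⁻¹ (g (HahnSeries.ofPowerSeries ℤ f X)) = HahnSeries.ofPowerSeries ℤ f X := by
      rw [← AlgEquiv.mul_apply, inv_mul_cancel, AlgEquiv.one_apply]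
    rw [ha, map_add, ← coe_res g⁻¹ (X ^ (n + 1) * a), hc] at h1
    rw [mul_neg, map_neg, eq_comm, ← sub_eq_add_neg, sub_eq_iff_eq_add, h1]

variable {f}

theorem mem_G [CharZero f] {n : ℕ} {g : G₀ f} :
    g ∈ G f n ↔ (X : f⟦X⟧) ^ (n + 1) ∣ res f g X - X := by
  constructor
  · rintro ⟨h, hh⟩
    refine ⟨h, ofPS_inj ?_⟩
    rw [map_sub, coe_res, hh]
    ring
  · rintro ⟨h, hh⟩
    refine ⟨h, ?_⟩
    rw [← coe_res, ← hh, map_sub]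
    ring

theorem X_pow_dvd_res_sub [CharZero f] {n : ℕ} {g : G₀ f} (hg : g ∈ G f n) (h : f⟦X⟧) :
    (X : f⟦X⟧) ^ (n + 1) ∣ res f g h - h := by
  have key : ∀ N ≤ n + 1, ∀ h : f⟦X⟧, (X : f⟦X⟧) ^ N ∣ res f g h - h := by
    intro N
    induction N with
    | zero => intro _ h; simp
    | succ N ih =>
      intro hN h
      obtain ⟨q, hq⟩ : (X : f⟦X⟧) ∣ h - C (constantCoeff h) := by
        rw [PowerSeries.X_dvd_iff]; simp
      have hC : res f g (C (constantCoeff h)) = C (constantCoeff h) :=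
        (res f g).commutes (constantCoeff h)
      have e : res f g h - h = (res f g X - X) * res f g q + X * (res f g q - q) := by
        have : h = X * q + C (constantCoeff h) := by rw [← hq]; ring
        rw [this, map_add, map_mul, hC]
        ring
      rw [e]
      refine dvd_add (((pow_dvd_pow _ hN).trans (mem_G.1 hg)).mul_right _) ?_
      rw [pow_succ']
      exact mul_dvd_mul_left _ (ih (by omega) q)
  exact key _ le_rfl h

instance G_normal [CharZero f] (n : ℕ) : (G f n).Normal where
  conj_mem h hh g := by
    rw [mem_G]
    have e : res f (g * h * g⁻¹) X - X
        = res f g (res f h (res f g⁻¹ X) - res f g⁻¹ X) := by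
      have h1 : res f g (res f g⁻¹ X) = X := by
        rw [← AlgEquiv.mul_apply, ← map_mul, mul_inv_cancel, map_one, AlgEquiv.one_apply]
      rw [map_sub, h1, map_mul, map_mul, AlgEquiv.mul_apply, AlgEquiv.mul_apply]
    rw [e]
    exact X_pow_dvd_res g (X_pow_dvd_res_sub hh _)

variable (f)

/-- The group `G_{mn} = G_m / G_n`, for `m ≤ n`. -/
abbrev Gq [CharZero f] (m n : ℕ) : Type _ := G f m ⧸ (G f n).subgroupOf (G f m)

/-! ### The adjoint and the co-adjoint representations -/

variable {f}

/-- The image `σ ∘ D ∘ σ⁻¹` of the vector field `D` under the automorphism `σ`. -/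
def conj (σ : f⟦X⟧ ≃ₐ[f] f⟦X⟧) (D : W₁ f) : W₁ f :=
  Derivation.mk' (σ.toLinearMap ∘ₗ (D : f⟦X⟧ →ₗ[f] f⟦X⟧) ∘ₗ σ.symm.toLinearMap) (by
    intro a b
    simp)

@[simp]
theorem conj_apply (σ : f⟦X⟧ ≃ₐ[f] f⟦X⟧) (D : W₁ f) (h : f⟦X⟧) :
    conj σ D h = σ (D (σ.symm h)) := rfl

theorem res_symm [CharZero f] (g : G₀ f) : (res f g).symm = res f g⁻¹ := by
  rw [map_inv]; rfl

theorem conj_mem [CharZero f] (g : G₀ f) {n : ℕ} {D : W₁ f} (hD : D ∈ L f n) :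
    conj (res f g) D ∈ L f n := by
  rw [mem_L, conj_apply, deriv_apply]
  exact X_pow_dvd_res g (hD.mul_left _)

theorem conj_sub_mem [CharZero f] {m n : ℕ} {g : G₀ f} (hg : g ∈ G f n) {D : W₁ f}
    (hD : D ∈ L f m) : conj (res f g) D - D ∈ L f n := by
  obtain ⟨r, hr⟩ := mem_G.1 (inv_mem hg)
  have h1 : res f g⁻¹ X = X + X ^ (n + 1) * r := by rw [← hr]; ring
  rw [mem_L, Derivation.sub_apply, conj_apply, res_symm, h1, map_add, map_add]
  have e : res f g (D X) + res f g (D (X ^ (n + 1) * r)) - D X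
      = (res f g (D X) - D X) + res f g (D (X ^ (n + 1) * r)) := by ring
  rw [e]
  exact dvd_add (X_pow_dvd_res_sub hg _)
    (X_pow_dvd_res g (deriv_X_pow_mul D (X_dvd_of_mem_L hD) r))

variable (f)

/-- The standard (adjoint) representation of `G_m` on `L_m`. -/
def Ad [CharZero f] (m : ℕ) : Representation f (G f m) (L f m) where
  toFun g :=
    { toFun := fun D => ⟨conj (res f g) D, conj_mem _ D.2⟩
      map_add' := fun D E => by
        ext h
        simp
      map_smul' := fun c D => by
        ext h
        simp }
  map_one' := by
    ext D : 1
    apply Subtype.ext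
    apply Derivation.ext
    intro h
    simp [← AlgEquiv.aut_inv]
  map_mul' g₁ g₂ := by
    ext D : 1
    apply Subtype.ext
    apply Derivation.ext
    intro h
    simp [← AlgEquiv.aut_inv, AlgEquiv.mul_apply]

/-- The representation of `G_m` on `L_{mn} = L_m / L_n`. -/
def AdQ₀ [CharZero f] (m n : ℕ) : Representation f (G f m) (Lq f m n) :=
  (Ad f m).quotient (LIdeal f m n).toSubmodule (fun g _ hD => conj_mem (g : G₀ f) hD)

instance AdQ₀_trivial [CharZero f] (m n : ℕ) : Representation.IsTrivial
    ((AdQ₀ f m n).comp ((G f n).subgroupOf (G f m)).subtype) where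
  out g := by
    apply Submodule.linearMap_qext
    ext D
    exact (Submodule.Quotient.eq _).2 (conj_sub_mem (Subgroup.mem_subgroupOf.1 g.2) D.2)

/-- The adjoint representation of `G_{mn} = G_m / G_n` on `L_{mn} = L_m / L_n`. -/
def AdQ [CharZero f] (m n : ℕ) : Representation f (Gq f m n) (Lq f m n) :=
  Representation.ofQuotient (AdQ₀ f m n) ((G f n).subgroupOf (G f m))

/-- The co-adjoint representation of `G_{mn}` on the space of linear forms on `L_{mn}`. -/
def coad [CharZero f] (m n : ℕ) : Representation f (Gq f m n) (Module.Dual f (Lq f m n)) :=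
  (AdQ f m n).dual

/-- The space `L_m^*`, the union of the `L_{mn}^*`: linear forms on `L_m` that vanish on some
`L_n`. -/
def Lstar (m : ℕ) : Submodule f (Module.Dual f (L f m)) where
  carrier := {φ | ∃ n, ∀ D : L f m, (D : W₁ f) ∈ L f n → φ D = 0}
  add_mem' := by
    rintro φ ψ ⟨a, ha⟩ ⟨b, hb⟩
    refine ⟨max a b, fun D hD => ?_⟩
    rw [LinearMap.add_apply, ha D (L_antitone (le_max_left _ _) hD),
      hb D (L_antitone (le_max_right _ _) hD), add_zero]
  zero_mem' := ⟨0, fun _ _ => rfl⟩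
  smul_mem' := by
    rintro c φ ⟨a, ha⟩
    exact ⟨a, fun D hD => by rw [LinearMap.smul_apply, ha D hD, smul_zero]⟩

/-- The co-adjoint representation of `G_m` on `L_m^*`. -/
def coadStar [CharZero f] (m : ℕ) : Representation f (G f m) (Lstar f m) :=
  (Ad f m).dual.subrepresentation (Lstar f m) (by
    rintro g φ ⟨n, hn⟩
    exact ⟨n, fun D hD => hn _ (conj_mem _ hD)⟩)

variable {f}

/-- The inclusion `L_{mn}^* ⊆ L_{mi}^*`, for `n ≤ i`, dual to the projection `L_{mi} → L_{mn}`. -/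
def incl (m : ℕ) {n i : ℕ} (h : n ≤ i) :
    Module.Dual f (Lq f m n) →ₗ[f] Module.Dual f (Lq f m i) :=
  Module.Dual.transpose (R := f) (Submodule.mapQ (LIdeal f m i).toSubmodule
    (LIdeal f m n).toSubmodule LinearMap.id (fun _ hD => L_antitone h hD))

/-- The inclusion `L_{mn}^* ⊆ L_m^*`, dual to the projection `L_m → L_{mn}`. -/
def inclStar (m n : ℕ) : Module.Dual f (Lq f m n) →ₗ[f] Lstar f m :=
  (Module.Dual.transpose (R := f) (LIdeal f m n).toSubmodule.mkQ).codRestrict (Lstar f m)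
    (fun φ => ⟨n, fun D hD => by
      have h : (LIdeal f m n).toSubmodule.mkQ D = 0 := (Submodule.Quotient.mk_eq_zero _).2 hD
      exact (congrArg φ h).trans (map_zero φ)⟩)

/-! ### Orbits, dimensions and general position -/

/-- `O` is an orbit of the representation `ρ`. -/
def IsOrbit {Γ V : Type*} [Group Γ] [AddCommGroup V] [Module f V] (ρ : Representation f Γ V)
    (O : Set V) : Prop :=
  ∃ v : V, O = Set.range fun g : Γ => ρ g v

/-- The dimension of (the Zariski closure of) a set of points of an affine space: the Krull
dimension of its coordinate ring. -/
def zariskiDim {N : ℕ} (S : Set (Fin N → f)) : WithBot ℕ∞ :=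
  ringKrullDim (MvPolynomial (Fin N) f ⧸ MvPolynomial.vanishingIdeal f S)

/-- `S` is the set of points of an (irreducible, closed) affine variety of dimension `d`. -/
structure IsAffineVariety {N : ℕ} (S : Set (Fin N → f)) (d : ℕ) : Prop where
  closed : MvPolynomial.zeroLocus f (MvPolynomial.vanishingIdeal f S) = S
  irreducible : (MvPolynomial.vanishingIdeal f S).IsPrime
  dim_eq : zariskiDim S = d

/-- `O` is an affine plane (a coset of a linear subspace) of dimension `d`. -/
def IsAffinePlane (K : Type*) [Field K] {V : Type*} [AddCommGroup V] [Module K V] (O : Set V)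
    (d : ℕ) : Prop :=
  ∃ A : AffineSubspace K V, (A : Set V) = O ∧ O.Nonempty ∧ Module.finrank K A.direction = d

/-- For `m ≤ j ≤ n`, the image in `L_{jn}^*` of a set `O` of linear forms on `L_{mn}` under the
restriction of linear forms to the ideal `L_{jn}` of `L_{mn}`, written in the coordinates
`l_j, …, l_{n-1}`. For `j = m` this is `O` itself, in coordinates. -/
def restrictTo {m n : ℕ} (j : ℕ) (O : Set (Module.Dual f (Lq f m n))) : Set (Fin (n - j) → f) :=
  (fun (φ : Module.Dual f (Lq f m n)) (r : Fin (n - j)) => φ (lq f m n (j + r))) '' O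

/-- `O` is an orbit in general position of the co-adjoint representation of `G_{mn}`: it is an
orbit, and its image in each space `L_{jn}^*` of the filtration
`L_{mn} ⊇ L_{m+1,n} ⊇ ⋯ ⊇ L_{nn} = 0` has the maximal dimension that is possible for an orbit. -/
def InGeneralPosition [CharZero f] (m n : ℕ) (O : Set (Module.Dual f (Lq f m n))) : Prop :=
  IsOrbit (coad f m n) O ∧
    ∀ j, m ≤ j → j ≤ n → ∀ O' : Set (Module.Dual f (Lq f m n)), IsOrbit (coad f m n) O' →
      zariskiDim (restrictTo j O') ≤ zariskiDim (restrictTo j O)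

end Field

/-! ### The polynomials `P_{mk}` -/

section Poly

/-- The square root `∑ binom(1/2, j) (S - 1) ^ j`, with constant term `1`, of a power series `S`
with constant term `1`. -/
def sqrtSeries {A : Type*} [CommRing A] [Algebra ℚ A] (S : A⟦X⟧) : A⟦X⟧ :=
  (binomialSeries A (1 / 2 : ℚ)).subst (S - 1)

theorem sqrtSeries_mul_self {A : Type*} [CommRing A] [Algebra ℚ A] {S : A⟦X⟧}
    (hS : constantCoeff S = 1) : sqrtSeries S * sqrtSeries S = S := by
  have hs : PowerSeries.HasSubst (S - 1) :=
    PowerSeries.HasSubst.of_constantCoeff_zero' (by simp [hS])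
  have h1 : binomialSeries A (1 : ℚ) = 1 + X := by
    simpa using PowerSeries.binomialSeries_nat (R := ℚ) (A := A) 1
  rw [sqrtSeries, ← PowerSeries.subst_mul hs, ← PowerSeries.binomialSeries_add]
  norm_num
  rw [h1, ← PowerSeries.coe_substAlgHom hs, map_add, map_one, PowerSeries.coe_substAlgHom hs,
    PowerSeries.subst_X hs]
  ring

variable (f : Type*) [Field f]

/-- The series `∑_{k ≥ 0} x_k x_0 ^ (k - 1) z ^ k`, whose constant term is `x_0 x_0⁻¹ = 1`. -/
def xSeries : (MvPolynomial ℕ f)⟦X⟧ :=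
  PowerSeries.mk fun k => if k = 0 then 1 else MvPolynomial.X k * MvPolynomial.X 0 ^ (k - 1)

/-- The partial sum `∑_{0 ≤ k ≤ m} x_k x_0 ^ (k - 1) z ^ k`. -/
def xSum (m : ℕ) : (MvPolynomial ℕ f)⟦X⟧ := (PowerSeries.trunc (m + 1) (xSeries f) : _)

variable {f}

theorem xSum_coeff (m N : ℕ) :
    coeff N (xSum f m) = if N < m + 1 then coeff N (xSeries f) else 0 := by
  rw [xSum, Polynomial.coeff_coe, PowerSeries.coeff_trunc]

theorem hasSubst_xSeries : PowerSeries.HasSubst (xSeries f - 1) :=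
  PowerSeries.HasSubst.of_constantCoeff_zero' (by
    rw [← PowerSeries.coeff_zero_eq_constantCoeff_apply]; simp [xSeries])

theorem hasSubst_xSum (m : ℕ) : PowerSeries.HasSubst (xSum f m - 1) :=
  PowerSeries.HasSubst.of_constantCoeff_zero' (by
    rw [map_sub, ← PowerSeries.coeff_zero_eq_constantCoeff_apply, xSum_coeff]; simp [xSeries])

theorem diff_pow_coeff (m N j : ℕ) :
    coeff N ((xSeries f - 1) ^ j - (xSum f m - 1) ^ j) = 0 ∨
      (m < N ∧ (MvPolynomial.X 0 : MvPolynomial ℕ f) ^ m ∣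
        coeff N ((xSeries f - 1) ^ j - (xSum f m - 1) ^ j)) := by
  rcases Nat.eq_zero_or_pos j with rfl | hj
  · left; simp
  set x₀ : MvPolynomial ℕ f := MvPolynomial.X 0
  set U : (MvPolynomial ℕ f)⟦X⟧ :=
    PowerSeries.mk fun k => if k = 0 then 0 else MvPolynomial.X k with hU
  set V : (MvPolynomial ℕ f)⟦X⟧ :=
    PowerSeries.mk fun k => if k < m + 1 then (if k = 0 then 0 else MvPolynomial.X k) else 0 with hV
  have hTU : C x₀ * (xSeries f - 1) = PowerSeries.rescale x₀ U := by
    ext1 k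
    rw [PowerSeries.coeff_C_mul, PowerSeries.coeff_rescale, map_sub, PowerSeries.coeff_one]
    rcases k with _ | k
    · simp [xSeries, hU]
    · simp [xSeries, hU, x₀]
      ring
  have hTV : C x₀ * (xSum f m - 1) = PowerSeries.rescale x₀ V := by
    ext1 k
    rw [PowerSeries.coeff_C_mul, PowerSeries.coeff_rescale, map_sub, PowerSeries.coeff_one,
      xSum_coeff]
    rcases k with _ | k
    · simp [xSeries, hV]
    · by_cases hk : k < m
      · simp [xSeries, hV, x₀, hk]
        ring
      · simp [hV, hk]
  have hdvd : (X : (MvPolynomial ℕ f)⟦X⟧) ^ (m + j) ∣ U ^ j - V ^ j := by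
    have hXU : (X : (MvPolynomial ℕ f)⟦X⟧) ∣ U := by
      rw [PowerSeries.X_dvd_iff, ← PowerSeries.coeff_zero_eq_constantCoeff_apply]; simp [hU]
    have hXV : (X : (MvPolynomial ℕ f)⟦X⟧) ∣ V := by
      rw [PowerSeries.X_dvd_iff, ← PowerSeries.coeff_zero_eq_constantCoeff_apply]; simp [hV]
    have hUV : (X : (MvPolynomial ℕ f)⟦X⟧) ^ (m + 1) ∣ U - V := by
      rw [PowerSeries.X_pow_dvd_iff]
      intro k hk
      simp only [hU, hV, map_sub, PowerSeries.coeff_mk, if_pos hk, sub_self]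
    rw [← (Commute.all U V).mul_geom_sum₂ j, show m + j = (m + 1) + (j - 1) by omega, pow_add]
    refine mul_dvd_mul hUV (Finset.dvd_sum fun i hi => ?_)
    have hi' := Finset.mem_range.1 hi
    rw [show j - 1 = i + (j - 1 - i) by omega, pow_add]
    have := mul_dvd_mul (pow_dvd_pow_of_dvd hXU i) (pow_dvd_pow_of_dvd hXV (j - 1 - i))
    rwa [show i + (j - 1 - i) - i = j - 1 - i by omega]
  have hscale : x₀ ^ j * coeff N ((xSeries f - 1) ^ j - (xSum f m - 1) ^ j)
      = x₀ ^ N * coeff N (U ^ j - V ^ j) := by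
    rw [← PowerSeries.coeff_rescale, map_sub (PowerSeries.rescale x₀), map_pow, map_pow, ← hTU, ← hTV, mul_pow, mul_pow,
      ← mul_sub, ← map_pow, PowerSeries.coeff_C_mul]
  have hx : x₀ ^ j ≠ 0 := pow_ne_zero _ (MvPolynomial.X_ne_zero 0)
  by_cases hN : N < m + j
  · left
    rw [PowerSeries.X_pow_dvd_iff.1 hdvd N hN, mul_zero] at hscale
    exact (mul_eq_zero.1 hscale).resolve_left hx
  · right
    refine ⟨by omega, x₀ ^ (N - m - j) * coeff N (U ^ j - V ^ j), mul_left_cancel₀ hx ?_⟩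
    rw [hscale, show N = j + (m + (N - m - j)) by omega, pow_add, pow_add,
      show j + (m + (N - m - j)) - m - j = N - m - j by omega]
    ring

variable (f) [CharZero f]

/-- The polynomial `P_{mk}`: the coefficient of `z ^ k` in
`(√(∑_{k ≥ 0} x_k x_0 ^ (k - 1) z ^ k) - √(∑_{k ≤ m} x_k x_0 ^ (k - 1) z ^ k)) / (x_0 z) ^ m`.
The division by `x_0 ^ m` is exact. -/
def P (m k : ℕ) : MvPolynomial ℕ f :=
  (coeff (m + k) (sqrtSeries (xSeries f) - sqrtSeries (xSum f m))).divMonomial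
    (Finsupp.single 0 m)

variable {f}

theorem diff_coeff (m N : ℕ) :
    coeff N (sqrtSeries (xSeries f) - sqrtSeries (xSum f m)) = 0 ∨
      (m < N ∧ (MvPolynomial.X 0 : MvPolynomial ℕ f) ^ m ∣
        coeff N (sqrtSeries (xSeries f) - sqrtSeries (xSum f m))) := by
  have e : coeff N (sqrtSeries (xSeries f) - sqrtSeries (xSum f m)) =
      ∑ᶠ j : ℕ, coeff j (binomialSeries (MvPolynomial ℕ f) (1 / 2 : ℚ)) •
        coeff N ((xSeries f - 1) ^ j - (xSum f m - 1) ^ j) := by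
    rw [map_sub, sqrtSeries, sqrtSeries, PowerSeries.coeff_subst' hasSubst_xSeries,
      PowerSeries.coeff_subst' (hasSubst_xSum m),
      ← finsum_sub_distrib (PowerSeries.coeff_subst_finite' hasSubst_xSeries _ _)
        (PowerSeries.coeff_subst_finite' (hasSubst_xSum m) _ _)]
    simp only [map_sub, smul_sub]
  by_cases hN : m < N
  · right
    refine ⟨hN, ?_⟩
    rw [e]
    refine finsum_induction (p := fun q => (MvPolynomial.X 0 : MvPolynomial ℕ f) ^ m ∣ q)
      (dvd_zero _) (fun _ _ => dvd_add) (fun j => ?_)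
    rw [smul_eq_mul]
    rcases diff_pow_coeff (f := f) m N j with h | h
    · rw [h]; simp
    · exact h.2.mul_left _
  · left
    rw [e]
    refine finsum_eq_zero_of_forall_eq_zero fun j => ?_
    rcases diff_pow_coeff (f := f) m N j with h | h
    · rw [h, smul_zero]
    · exact absurd h.1 hN

/-- The polynomials `P_{mk}` satisfy the defining generating function identity. -/
theorem P_generating (m : ℕ) :
    C (MvPolynomial.X 0 ^ m) * X ^ m * PowerSeries.mk (P f m) =
      sqrtSeries (xSeries f) - sqrtSeries (xSum f m) := by
  ext1 N
  rw [mul_assoc, PowerSeries.coeff_C_mul, PowerSeries.coeff_X_pow_mul']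
  split_ifs with h
  · rw [PowerSeries.coeff_mk, P, Nat.add_sub_cancel' h]
    have hd : (MvPolynomial.X 0 : MvPolynomial ℕ f) ^ m ∣
        coeff N (sqrtSeries (xSeries f) - sqrtSeries (xSum f m)) := by
      rcases diff_coeff (f := f) m N with h | h
      · rw [h]; exact dvd_zero _
      · exact h.2
    obtain ⟨q, hq⟩ := hd
    rw [hq, MvPolynomial.X_pow_eq_monomial, MvPolynomial.divMonomial_monomial_mul]
  · rw [mul_zero]
    rcases diff_coeff (f := f) m N with h' | h'
    · exact h'.symm
    · exact absurd h'.1.le h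

theorem P_zero (m : ℕ) : P f m 0 = 0 := by
  rcases diff_coeff (f := f) m (m + 0) with h | h
  · rw [P, h, MvPolynomial.zero_divMonomial]
  · exact absurd h.1 (lt_irrefl m)

end Poly

end FormalLine
end

open FormalLine

noncomputable section

namespace FormalLine

open PowerSeries (X C constantCoeff coeff binomialSeries)

/-! ### Dimension and irreducibility of graphs of polynomial maps -/

section Geometry

variable {f : Type*} [Field f]

/-! Write `x_k` for the coordinate `l_{n-k}` of a linear form `φ` and put `F = ∑ x_k t^k`. Then
`φ(D)` is the residue of `F · D(t) · t^(-n-2) dt` (`dual_toLq`), so `φ` is a truncated quadratic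
differential `F t^(-n-2) dt²`, and the group acts by change of variable (`coords_translate`).

An element `t + a t^(k+1) + …` of `G_k` fixes `x_j` for `j < k` and adds `(n - 2k) a x_0` to `x_k`
(`translate_lq`, from `conj_l_sub_mem`). For the group `G_{m+1}` this has three consequences. The
coordinates `x_0, …, x_m` are invariant. If `x_0 ≠ 0`, each `x_k` with `k > m` and `2k ≠ n` can be
given any value, in increasing order of `k`. If `x_0 = 0`, then `x_{m+1}` is invariant too.

The exceptional index `k = n/2` carries one more invariant. For `n = 2p` the quadratic differential
has a square root `√F t^(-p-1) dt`, a 1-form, and residues of 1-forms are invariant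
(`coeff_map_mul_derivative`). After normalizing by the invariant `x_0`, the residue is `sqrtCoeff x
p` (`sqrtCoeff_eq_of_mem_orbit`). It is affine in `x_p` with slope `1/(2 x_0)`, and for fixed `x_0,
…, x_m` it is an affine function of `P_{mk}`, `k = p - m` (`aeval_P`). Hence `mem_orbit_iff`: these
invariants separate the orbits with `x_0 ≠ 0`, and such an orbit is the graph of a polynomial map
over its free coordinates.

Counting free coordinates identifies general position with `x_0 ≠ 0` when `n > 2m + 2`
(`inGeneralPosition_iff`). A form with `x_0 = 0` comes from the level below, so descending until
`x_0 ≠ 0` or `n = 2m + 2` accounts for all orbits (`exists_level`). -/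

theorem zariskiDim_mono {N : ℕ} {S T : Set (Fin N → f)} (h : S ⊆ T) :
    zariskiDim S ≤ zariskiDim T :=
  ringKrullDim_le_of_surjective
    (Ideal.Quotient.factor (MvPolynomial.vanishingIdeal_anti_mono h))
    (Ideal.Quotient.factor_surjective _)

/-- The graph of a polynomial map, with free coordinates `A`, the others being given by `Q`. -/
def graphSet {N : ℕ} (A : Set (Fin N)) (Q : Fin N → MvPolynomial A f) : Set (Fin N → f) :=
  {x | ∀ r, r ∉ A → x r = MvPolynomial.aeval (fun a : A => x a) (Q r)}

open Classical in
/-- The restriction of polynomial functions to a graph. -/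
def graphEval {N : ℕ} (A : Set (Fin N)) (Q : Fin N → MvPolynomial A f) :
    MvPolynomial (Fin N) f →ₐ[f] MvPolynomial A f :=
  MvPolynomial.aeval fun r => if h : r ∈ A then MvPolynomial.X ⟨r, h⟩ else Q r

variable {N : ℕ} (A : Set (Fin N)) (Q : Fin N → MvPolynomial A f)

open Classical in
theorem graphEval_surjective : Function.Surjective (graphEval A Q) := by
  intro p
  refine ⟨MvPolynomial.rename Subtype.val p, ?_⟩
  rw [graphEval, MvPolynomial.aeval_rename]
  have : ((fun r => if h : r ∈ A then (MvPolynomial.X ⟨r, h⟩ : MvPolynomial A f) else Q r) ∘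
      (Subtype.val : A → Fin N)) = MvPolynomial.X := by
    funext a
    simp
  rw [this, MvPolynomial.aeval_X_left_apply]

theorem aeval_graphEval (y : A → f) (p : MvPolynomial (Fin N) f) :
    MvPolynomial.aeval y (graphEval A Q p) = MvPolynomial.aeval
      (fun r => MvPolynomial.aeval y (graphEval A Q (MvPolynomial.X r))) p := by
  rw [← AlgHom.comp_apply]
  congr 1
  refine MvPolynomial.algHom_ext fun r => ?_
  simp

/-- A polynomial vanishing on the graph pulls back to one vanishing at every choice of the free
coordinates, hence to zero, since a field of characteristic 0 is infinite. So the coordinate ring of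
a graph is a polynomial ring; this gives both its dimension and its irreducibility. -/
theorem vanishingIdeal_graphSet [CharZero f] :
    MvPolynomial.vanishingIdeal f (graphSet A Q) = RingHom.ker (graphEval A Q) := by
  ext p
  rw [MvPolynomial.mem_vanishingIdeal_iff, RingHom.mem_ker]
  constructor
  · intro h
    refine MvPolynomial.funext fun y => ?_
    rw [map_zero, ← MvPolynomial.coe_aeval_eq_eval]
    refine (aeval_graphEval A Q y p).trans ?_
    refine h _ fun r hr => ?_
    simp only [graphEval, MvPolynomial.aeval_X, dif_neg hr]
    congr 2
    funext a
    simp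
  · intro h x hx
    have := aeval_graphEval A Q (fun a => x a) p
    rw [show graphEval A Q p = 0 from h, map_zero] at this
    rw [this]
    congr 2
    funext r
    by_cases hr : r ∈ A
    · simp [graphEval, hr]
    · simpa [graphEval, hr] using hx r hr

theorem zariskiDim_graphSet [CharZero f] : zariskiDim (graphSet A Q) = (A.ncard : WithBot ℕ∞) := by
  rw [zariskiDim, vanishingIdeal_graphSet,
    
    ringKrullDim_eq_of_ringEquiv
      (Ideal.quotientKerAlgEquivOfSurjective (graphEval_surjective A Q)).toRingEquiv,
    MvPolynomial.ringKrullDim_of_isNoetherianRing, ringKrullDim_eq_zero_of_field, zero_add,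
    Nat.card_coe_set_eq]

theorem isAffineVariety_graphSet [CharZero f] : IsAffineVariety (graphSet A Q) A.ncard where
  closed := by
    refine le_antisymm (fun x hx r hr => ?_) (MvPolynomial.zeroLocus_vanishingIdeal_le _)
    have := hx (MvPolynomial.X r - MvPolynomial.rename Subtype.val (Q r)) (by
      rw [MvPolynomial.mem_vanishingIdeal_iff]
      intro y hy
      rw [map_sub, MvPolynomial.aeval_rename, MvPolynomial.aeval_X, sub_eq_zero]
      exact hy r hr)
    rw [map_sub, MvPolynomial.aeval_rename, MvPolynomial.aeval_X, sub_eq_zero] at this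
    exact this
  irreducible := by
    rw [vanishingIdeal_graphSet]
    exact RingHom.ker_isPrime _
  dim_eq := zariskiDim_graphSet A Q

theorem zariskiDim_singleton [CharZero f] (x : Fin N → f) : zariskiDim {x} = 0 := by
  have h : ({x} : Set (Fin N → f)) = graphSet ∅ fun r => MvPolynomial.C (x r) := by
    ext y
    simp [graphSet, funext_iff]
  rw [h, zariskiDim_graphSet]
  simp

/-- A point of a graph is determined by its free coordinates, so a subset that projects onto all of
them is everything. -/
theorem eq_graphSet {A : Set (Fin N)} {Q : Fin N → MvPolynomial A f}
    {S : Set (Fin N → f)} (h : S ⊆ graphSet A Q)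
    (h' : ∀ x : Fin N → f, ∃ s ∈ S, ∀ r ∈ A, s r = x r) : S = graphSet A Q := by
  refine h.antisymm fun x hx => ?_
  obtain ⟨s, hs, hsx⟩ := h' x
  have e : (fun a : A => s a) = fun a : A => x a := funext fun a => hsx a a.2
  suffices s = x by rwa [← this]
  funext r
  by_cases hr : r ∈ A
  · exact hsx r hr
  · rw [h hs r hr, hx r hr, e]

end Geometry

/-! ### Square roots of power series -/

section SquareRoots

variable {A : Type*} [CommRing A] [Algebra ℚ A]

theorem constantCoeff_sqrtSeries {S : A⟦X⟧} (hS : constantCoeff S = 1) :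
    constantCoeff (sqrtSeries S) = 1 := by
  have h0 : constantCoeff (S - 1) = 0 := by simp [hS]
  have h1 : constantCoeff ((binomialSeries A (1 / 2 : ℚ) - 1).subst (S - 1)) = 0 :=
    PowerSeries.constantCoeff_subst_eq_zero h0 _ (by simp)
  have hs := PowerSeries.HasSubst.of_constantCoeff_zero' h0
  rw [PowerSeries.subst_sub hs, map_sub, ← PowerSeries.coe_substAlgHom hs, map_one, map_one,
    PowerSeries.coe_substAlgHom hs, sub_eq_zero] at h1
  exact h1

variable {f : Type*} [Field f] [CharZero f]

theorem two_ne_zero_of_constantCoeff {S T : f⟦X⟧} (hS : constantCoeff S = 1)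
    (hT : constantCoeff T = 1) : constantCoeff (S + T) ≠ 0 := by
  rw [map_add, hS, hT]
  norm_num

theorem X_pow_dvd_sub_of_sq {S T : f⟦X⟧} (hS : constantCoeff S = 1) (hT : constantCoeff T = 1)
    {N : ℕ} (h : (X : f⟦X⟧) ^ N ∣ S * S - T * T) : (X : f⟦X⟧) ^ N ∣ S - T := by
  have hu : IsUnit (S + T) := PowerSeries.isUnit_iff_constantCoeff.2
    (isUnit_iff_ne_zero.2 (two_ne_zero_of_constantCoeff hS hT))
  rw [mul_self_sub_mul_self] at h
  exact (hu.dvd_mul_left).1 h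

theorem eq_of_sq_eq {S T : f⟦X⟧} (hS : constantCoeff S = 1) (hT : constantCoeff T = 1)
    (h : S * S = T * T) : S = T := by
  rw [mul_self_eq_mul_self_iff] at h
  refine h.resolve_right fun h => two_ne_zero_of_constantCoeff hS hT ?_
  rw [h]
  simp

theorem sqrtSeries_eq {S T : f⟦X⟧} (hS : constantCoeff S = 1) (hT : constantCoeff T = 1)
    (h : T * T = S) : sqrtSeries S = T :=
  eq_of_sq_eq (constantCoeff_sqrtSeries hS) hT (by rw [sqrtSeries_mul_self hS, h])

theorem map_sqrtSeries {S : A⟦X⟧} (hS : constantCoeff S = 1) (e : A →+* f) :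
    PowerSeries.map e (sqrtSeries S) = sqrtSeries (PowerSeries.map e S) := by
  have hmap : ∀ T : A⟦X⟧, constantCoeff (PowerSeries.map e T) = e (constantCoeff T) := fun T => by
    rw [← PowerSeries.coeff_zero_eq_constantCoeff_apply, PowerSeries.coeff_map,
      PowerSeries.coeff_zero_eq_constantCoeff_apply]
  refine (sqrtSeries_eq ?_ ?_ ?_).symm
  · simp [hmap, hS]
  · simp [hmap, constantCoeff_sqrtSeries hS]
  · rw [← map_mul, sqrtSeries_mul_self hS]

theorem rescale_sqrtSeries {S : f⟦X⟧} (hS : constantCoeff S = 1) (c : f) :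
    PowerSeries.rescale c (sqrtSeries S) = sqrtSeries (PowerSeries.rescale c S) := by
  have h : ∀ T : f⟦X⟧, constantCoeff (PowerSeries.rescale c T) = constantCoeff T := fun T => by
    rw [← PowerSeries.coeff_zero_eq_constantCoeff_apply, PowerSeries.coeff_rescale]
    simp
  refine (sqrtSeries_eq ?_ ?_ ?_).symm
  · rw [h, hS]
  · rw [h, constantCoeff_sqrtSeries hS]
  · rw [← map_mul, sqrtSeries_mul_self hS]

/-- In `S² - T² = (S + T)(S - T)` the first factor has constant term 2. Consequently the `N`-th
coefficient of a square root is affine in the `N`-th coefficient of the radicand, with slope `1/2`,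
once the lower ones are fixed. -/
theorem coeff_sub_of_sq {S T : f⟦X⟧} (hS : constantCoeff S = 1) (hT : constantCoeff T = 1)
    {N : ℕ} (h : (X : f⟦X⟧) ^ N ∣ S * S - T * T) :
    coeff N (S * S) - coeff N (T * T) = 2 * (coeff N S - coeff N T) := by
  obtain ⟨q, hq⟩ := X_pow_dvd_sub_of_sq hS hT h
  rw [← map_sub, ← map_sub, mul_self_sub_mul_self, hq, mul_left_comm,
    PowerSeries.coeff_X_pow_mul', PowerSeries.coeff_X_pow_mul', if_pos le_rfl, if_pos le_rfl,
    Nat.sub_self, PowerSeries.coeff_zero_eq_constantCoeff_apply,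
    PowerSeries.coeff_zero_eq_constantCoeff_apply, map_mul, map_add, hS, hT]
  norm_num

theorem coeff_sqrtSeries_sub {S T : f⟦X⟧} (hS : constantCoeff S = 1) (hT : constantCoeff T = 1)
    {N : ℕ} (h : ∀ k < N, coeff k S = coeff k T) :
    coeff N S - coeff N T = 2 * (coeff N (sqrtSeries S) - coeff N (sqrtSeries T)) := by
  have := coeff_sub_of_sq (constantCoeff_sqrtSeries hS) (constantCoeff_sqrtSeries hT) (N := N) (by
    rw [sqrtSeries_mul_self hS, sqrtSeries_mul_self hT, PowerSeries.X_pow_dvd_iff]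
    intro k hk
    rw [map_sub, h k hk, sub_self])
  rwa [sqrtSeries_mul_self hS, sqrtSeries_mul_self hT] at this

end SquareRoots

/-! ### The square-root coefficient and the polynomials `P_{mk}` -/

section Invariant

variable {f : Type*} [Field f]

/-- The series `∑ (x_k / x_0) z ^ k`, normalized to have constant term `1`. -/
def normSeries {A : Type*} [CommRing A] [Algebra f A] (c : f) (x : ℕ → A) : A⟦X⟧ :=
  PowerSeries.mk fun k => if k = 0 then 1 else c⁻¹ • x k

theorem constantCoeff_normSeries {A : Type*} [CommRing A] [Algebra f A] (c : f) (x : ℕ → A) :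
    constantCoeff (normSeries c x) = 1 := by
  rw [← PowerSeries.coeff_zero_eq_constantCoeff_apply]
  simp [normSeries]

theorem map_normSeries {A : Type*} [CommRing A] [Algebra f A] (c : f) (x : ℕ → A) (e : A →ₐ[f] f) :
    PowerSeries.map (e : A →+* f) (normSeries c x) = normSeries c fun k => e (x k) := by
  ext k
  simp only [normSeries, PowerSeries.coeff_map, PowerSeries.coeff_mk]
  split_ifs <;> simp

variable [CharZero f]

/-- The coefficient of `z ^ N` in the square root of `∑ (x_k / x_0) z ^ k`. -/
def sqrtCoeff (x : ℕ → f) (N : ℕ) : f := coeff N (sqrtSeries (normSeries (x 0) x))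

/-- Makes it possible to solve for `x N` from the lower terms and the invariant, by comparison with
a reference sequence `y`. -/
theorem sqrtCoeff_sub {x y : ℕ → f} {N : ℕ} (hN : 0 < N) (h : ∀ k < N, x k = y k) :
    x N - y N = 2 * x 0 * (sqrtCoeff x N - sqrtCoeff y N) ∨ x 0 = 0 := by
  by_cases h0 : x 0 = 0
  · exact Or.inr h0
  left
  have := coeff_sqrtSeries_sub (constantCoeff_normSeries (x 0) x) (constantCoeff_normSeries (y 0) y)
    (N := N) (fun k hk => by simp [normSeries, h k hk, h 0 hN])
  rw [mul_right_comm, sqrtCoeff, sqrtCoeff, ← this]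
  simp only [normSeries, PowerSeries.coeff_mk, hN.ne', if_false, h 0 hN, smul_eq_mul]
  rw [h 0 hN] at h0
  field_simp

theorem sqrtCoeff_congr {x y : ℕ → f} {N : ℕ} (h : ∀ k ≤ N, x k = y k) :
    sqrtCoeff x N = sqrtCoeff y N := by
  have := coeff_sqrtSeries_sub (constantCoeff_normSeries (x 0) x) (constantCoeff_normSeries (y 0) y)
    (N := N) (fun k hk => by simp [normSeries, h k hk.le, h 0 (Nat.zero_le _)])
  have h2 : coeff N (normSeries (x 0) x) = coeff N (normSeries (y 0) y) := by
    simp [normSeries, h N le_rfl, h 0 (Nat.zero_le _)]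
  rw [h2, sub_self, eq_comm, mul_eq_zero, sub_eq_zero] at this
  exact this.resolve_left two_ne_zero

/-- For fixed `x_0 ≠ 0, …, x_m`, the polynomial `P_{mk}` is an affine function of the coefficient
of `z ^ (m + k)` in the square root of `∑ (x_k / x_0) z ^ k`. -/
theorem aeval_P (x : ℕ → f) (hx : x 0 ≠ 0) (m k : ℕ) :
    x 0 ^ m * MvPolynomial.aeval x (P f m k) =
      x 0 ^ (m + k) * (sqrtCoeff x (m + k) -
        sqrtCoeff (fun i => if i ≤ m then x i else 0) (m + k)) := by
  have hc : constantCoeff (xSeries f) = 1 := by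
    rw [← PowerSeries.coeff_zero_eq_constantCoeff_apply]; simp [xSeries]
  have hcm : constantCoeff (xSum f m) = 1 := by
    rw [← PowerSeries.coeff_zero_eq_constantCoeff_apply, xSum_coeff]; simp [xSeries]
  set e : MvPolynomial ℕ f →+* f := (MvPolynomial.aeval x).toRingHom
  have key := congrArg (fun S => coeff (m + k) (PowerSeries.map e S)) (P_generating (f := f) m)
  simp only [map_mul, map_sub, map_sqrtSeries hc, map_sqrtSeries hcm] at key
  -- Since `x_k x_0^(k-1) = x_0^k (x_k / x_0)`, the series defining `P` is the normalized one in the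
  -- variable `x_0 z`.
  have h1 : PowerSeries.map e (xSeries f) = PowerSeries.rescale (x 0) (normSeries (x 0) x) := by
    ext k
    rcases k with _ | k
    · simp [xSeries, normSeries]
    · simp [xSeries, normSeries, e]
      field_simp
      ring
  have h2 : PowerSeries.map e (xSum f m) = PowerSeries.rescale (x 0)
      (normSeries (x 0) (fun i => if i ≤ m then x i else 0)) := by
    ext k
    rw [PowerSeries.coeff_map, xSum_coeff, PowerSeries.coeff_rescale]
    rcases k with _ | k
    · simp [xSeries, normSeries]
    · by_cases hk : k + 1 ≤ m
      · simp [xSeries, normSeries, e, hk]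
        field_simp
        ring
      · simp [normSeries, hk]
  rw [h1, h2, ← rescale_sqrtSeries (constantCoeff_normSeries _ _),
    ← rescale_sqrtSeries (constantCoeff_normSeries _ _), PowerSeries.coeff_rescale,
    PowerSeries.coeff_rescale, ← mul_sub] at key
  simp only [sqrtCoeff, Nat.zero_le, if_true]
  rw [← key]
  rw [PowerSeries.map_C, map_pow (PowerSeries.map e), PowerSeries.map_X, mul_assoc,
    PowerSeries.coeff_C_mul, PowerSeries.coeff_X_pow_mul', if_pos (Nat.le_add_right m k),
    Nat.add_sub_cancel_left, PowerSeries.coeff_map, PowerSeries.coeff_mk, map_pow]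
  simp [e]

end Invariant

/-! ### Invariance of residues under change of variable -/

section Residues

variable {f : Type*} [Field f]

/-- This is the residue of `s^(-N-1) ds` for `s = t u`. For `N > 0` the form is the differential of
`-s^(-N)/N`, so it has no residue; characteristic 0 allows the division by `N`. -/
theorem coeff_derivative_X_mul_mul_pow [CharZero f] {u v : f⟦X⟧} (huv : u * v = 1) (N : ℕ) :
    coeff N (PowerSeries.derivative f (X * u) * v ^ (N + 1)) = if N = 0 then 1 else 0 := by
  have hd : PowerSeries.derivative f (X * u) * v ^ (N + 1)
      = v ^ N + X * (PowerSeries.derivative f u * v ^ (N + 1)) := by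
    rw [Derivation.leibniz, PowerSeries.derivative_X, smul_eq_mul, smul_eq_mul, mul_one, add_mul,
      pow_succ]
    linear_combination (v ^ N) * huv
  rw [hd]
  rcases N with _ | N
  · simp
  rw [if_neg (Nat.succ_ne_zero N)]
  have hv : PowerSeries.derivative f v = - (PowerSeries.derivative f u * v ^ 2) := by
    have h := congrArg (PowerSeries.derivative f) huv
    rw [Derivation.leibniz, Derivation.map_one_eq_zero, smul_eq_mul, smul_eq_mul] at h
    linear_combination v * h - (PowerSeries.derivative f v) * huv
  have hp : PowerSeries.derivative f (v ^ (N + 1)) =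
      - (((N + 1 : ℕ) : f⟦X⟧) * (PowerSeries.derivative f u * v ^ (N + 1 + 1))) := by
    rw [Derivation.leibniz_pow, hv, smul_eq_mul, nsmul_eq_mul, Nat.add_sub_cancel]
    ring
  have hc := PowerSeries.coeff_derivative (v ^ (N + 1)) N
  rw [hp, map_neg, ← nsmul_eq_mul, map_nsmul, nsmul_eq_mul] at hc
  rw [map_add, PowerSeries.coeff_succ_X_mul]
  have hN : ((N + 1 : ℕ) : f) ≠ 0 := Nat.cast_ne_zero.2 (Nat.succ_ne_zero N)
  refine (mul_eq_zero.1 ?_).resolve_left hN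
  push_cast at hc ⊢
  linear_combination -hc

/-- Invariance of the residue of `F(t) t ^ (-N - 1) dt` under automorphisms. -/
theorem coeff_map_mul_derivative [CharZero f] (σ : f⟦X⟧ ≃ₐ[f] f⟦X⟧) {u v : f⟦X⟧}
    (hu : σ X = X * u) (huv : u * v = 1) (N : ℕ) :
    ∀ F : f⟦X⟧, coeff N (σ F * PowerSeries.derivative f (σ X) * v ^ (N + 1)) = coeff N F := by
  have hsplit : ∀ F : f⟦X⟧, ∃ q : f⟦X⟧, F = C (constantCoeff F) + X * q := fun F => by
    obtain ⟨q, hq⟩ : (X : f⟦X⟧) ∣ F - C (constantCoeff F) := by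
      rw [PowerSeries.X_dvd_iff]; simp
    exact ⟨q, by rw [← hq]; ring⟩
  have hC : ∀ c : f, σ (C c) = C c := σ.commutes
  induction N with
  | zero =>
    intro F
    obtain ⟨q, hq⟩ := hsplit F
    have h0 := coeff_derivative_X_mul_mul_pow huv 0
    rw [← hu] at h0
    have e : σ F * PowerSeries.derivative f (σ X) * v ^ (0 + 1) =
        C (constantCoeff F) * (PowerSeries.derivative f (σ X) * v ^ (0 + 1)) +
          X * (u * σ q * PowerSeries.derivative f (σ X) * v ^ (0 + 1)) := by
      conv_lhs => rw [hq, map_add, map_mul, hC]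
      rw [show σ X * σ q = X * u * σ q by rw [hu]]
      ring
    rw [e, map_add, PowerSeries.coeff_C_mul, h0]
    simp
  | succ N ih =>
    intro F
    obtain ⟨q, hq⟩ := hsplit F
    have h0 := coeff_derivative_X_mul_mul_pow huv (N + 1)
    rw [← hu, if_neg (Nat.succ_ne_zero N)] at h0
    -- The constant term of `F` contributes nothing by `h0`. In the remaining part, `σ X = X u`
    -- absorbs one factor `v` and lowers the order of the pole, which leads back to `N`.
    have e : σ F * PowerSeries.derivative f (σ X) * v ^ (N + 1 + 1) =
        C (constantCoeff F) * (PowerSeries.derivative f (σ X) * v ^ (N + 1 + 1)) +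
          X * (σ q * PowerSeries.derivative f (σ X) * v ^ (N + 1)) := by
      conv_lhs => rw [hq, map_add, map_mul, hC]
      rw [add_mul, add_mul, mul_assoc (C _)]
      congr 1
      rw [show σ X * σ q = X * u * σ q by rw [hu], pow_succ _ (N + 1)]
      linear_combination (X * σ q * PowerSeries.derivative f (σ X) * v ^ (N + 1)) * huv
    rw [e, map_add, PowerSeries.coeff_C_mul, h0, mul_zero, zero_add,
      PowerSeries.coeff_succ_X_mul, ih]
    conv_rhs => rw [hq]
    rw [map_add, PowerSeries.coeff_succ_X_mul, PowerSeries.coeff_C, if_neg (Nat.succ_ne_zero N),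
      zero_add]

theorem sq_dvd_one_add_pow_sub {R : Type*} [CommRing R] (y : R) (n : ℕ) :
    y ^ 2 ∣ (1 + y) ^ n - 1 - n * y := by
  induction n with
  | zero => simp
  | succ n ih =>
    obtain ⟨q, hq⟩ := ih
    refine ⟨q * (1 + y) + n, ?_⟩
    push_cast
    linear_combination (1 + y) * hq

end Residues

/-! ### Automorphisms and their action on vector fields -/

section Automorphisms

variable {f : Type*} [Field f]

/-- The chain rule for an abstract automorphism: every derivation is a multiple of `d/dt`, in
particular the conjugate of `d/dt` by `σ⁻¹`. -/
theorem derivative_map (σ : f⟦X⟧ ≃ₐ[f] f⟦X⟧) (h : f⟦X⟧) :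
    PowerSeries.derivative f (σ h) =
      σ (PowerSeries.derivative f h) * PowerSeries.derivative f (σ X) := by
  have := congrArg σ (deriv_apply (conj σ.symm (PowerSeries.derivative f)) h)
  simpa using this

theorem conj_X_mul_derivative (σ : f⟦X⟧ ≃ₐ[f] f⟦X⟧) (D : W₁ f) :
    conj σ D X * PowerSeries.derivative f (σ X) = σ (D X) := by
  have h := derivative_map σ (σ.symm X)
  rw [AlgEquiv.apply_symm_apply, PowerSeries.derivative_X] at h
  rw [conj_apply, deriv_apply, map_mul]
  linear_combination - (σ (D X)) * h

theorem symm_conj_X (σ : f⟦X⟧ ≃ₐ[f] f⟦X⟧) (D : W₁ f) :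
    σ.symm (conj σ D X) = PowerSeries.derivative f (σ.symm X) * D X := by
  rw [conj_apply, AlgEquiv.symm_apply_apply, deriv_apply]

theorem l_apply_X (i : ℕ) : l f i X = X ^ (i + 1) := by
  simp [l]

variable [CharZero f]

theorem exists_leading_coeff {k : ℕ} {g : G₀ f} (hg : g ∈ G f k) :
    ∃ a : f, (X : f⟦X⟧) ^ (k + 2) ∣ res f g X - X - C a * X ^ (k + 1) := by
  obtain ⟨h, hh⟩ := mem_G.1 hg
  obtain ⟨q, hq⟩ : (X : f⟦X⟧) ∣ h - C (constantCoeff h) := by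
    rw [PowerSeries.X_dvd_iff]; simp
  exact ⟨constantCoeff h, q, by rw [hh]; linear_combination X ^ (k + 1) * hq⟩

/-- The leading term of the action of `G_k` on `l_i`. -/
theorem conj_l_sub_mem {k i : ℕ} (hk : 1 ≤ k) {σ : f⟦X⟧ ≃ₐ[f] f⟦X⟧} {a : f}
    (h : (X : f⟦X⟧) ^ (k + 2) ∣ σ X - X - C a * X ^ (k + 1)) :
    conj σ (l f i) - l f i - (((i : f) - k) * a) • l f (i + k) ∈ L f (i + k + 1) := by
  obtain ⟨r, hr⟩ := h
  have hσ : σ X = X + C a * X ^ (k + 1) + X ^ (k + 2) * r := by rw [← hr]; ring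
  have hd : PowerSeries.derivative f (σ X) =
      1 + ((k + 1 : ℕ) : f⟦X⟧) * C a * X ^ k +
        X ^ (k + 1) * (((k + 2 : ℕ) : f⟦X⟧) * r + X * PowerSeries.derivative f r) := by
    rw [hσ]
    simp only [map_add, Derivation.leibniz, Derivation.leibniz_pow, PowerSeries.derivative_X,
      PowerSeries.derivative_C, smul_eq_mul, nsmul_eq_mul, Nat.add_sub_cancel,
      show k + 2 - 1 = k + 1 from rfl]
    ring
  have hu : IsUnit (PowerSeries.derivative f (σ X)) := by
    rw [PowerSeries.isUnit_iff_constantCoeff, hd]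
    have : constantCoeff ((X : f⟦X⟧) ^ k) = 0 := by simp; omega
    simp [this]
  -- The conjugate of `l_i` has coefficient `σ(t)^(i+1) / σ'(t)`; multiplying by the unit `σ'`
  -- clears the denominator. The two first-order terms `(i + 1) a` and `(k + 1) a` then combine to
  -- `(i - k) a`.
  rw [mem_L, ← hu.dvd_mul_right]
  simp only [Derivation.sub_apply, Derivation.smul_apply, l_apply_X,
    sub_mul _ _ (PowerSeries.derivative f (σ X)), conj_X_mul_derivative, map_pow,
    PowerSeries.smul_eq_C_mul]
  obtain ⟨s, hs⟩ := sq_dvd_one_add_pow_sub ((X : f⟦X⟧) ^ k * (C a + X * r)) (i + 1)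
  have hpow : (σ X) ^ (i + 1) = X ^ (i + 1) * (1 + ((i + 1 : ℕ) : f⟦X⟧) *
      (X ^ k * (C a + X * r)) + (X ^ k * (C a + X * r)) ^ 2 * s) := by
    rw [← hs, hσ]
    rw [show X + C a * X ^ (k + 1) + X ^ (k + 2) * r = X * (1 + X ^ k * (C a + X * r)) by ring,
      mul_pow]
    ring
  -- With `k = j + 1` the second-order terms contain `X^(2k) = X^(k+1) X^j`, so they are negligible.
  obtain ⟨j, rfl⟩ : ∃ j, k = j + 1 := ⟨k - 1, by omega⟩
  have hc : (C (((i : f) - (j + 1 : ℕ)) * a) : f⟦X⟧) =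
      ((i : f⟦X⟧) - ((j + 1 : ℕ) : f⟦X⟧)) * C a := by
    simp
  rw [hpow, hd, hc]
  refine ⟨((i + 1 : ℕ) : f⟦X⟧) * r + X ^ j * (C a + X * r) ^ 2 * s -
    (((j + 1 + 2 : ℕ) : f⟦X⟧) * r + X * PowerSeries.derivative f r) -
    ((i : f⟦X⟧) - ((j + 1 : ℕ) : f⟦X⟧)) * C a * X ^ j * (((j + 1 + 1 : ℕ) : f⟦X⟧) * C a +
      X * (((j + 1 + 2 : ℕ) : f⟦X⟧) * r + X * PowerSeries.derivative f r)), ?_⟩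
  push_cast
  ring

/-- The substitution `t ↦ t + a t^(k+1)` has linear coefficient 1, so it is invertible under
composition; the resulting automorphism of `f⟦t⟧` extends to the fraction field. -/
theorem exists_mem_G {k : ℕ} (hk : 1 ≤ k) (a : f) :
    ∃ g ∈ G f k, (X : f⟦X⟧) ^ (k + 2) ∣ res f g X - X - C a * X ^ (k + 1) := by
  set p : f⟦X⟧ := X + C a * X ^ (k + 1) with hp
  have hp0 : constantCoeff p = 0 := by simp [hp]
  have hp1 : IsUnit (coeff 1 p) := by
    have : k ≠ 0 := by omega
    simp [hp, PowerSeries.coeff_X_pow, PowerSeries.coeff_one_X, this]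
  have hs : PowerSeries.HasSubst p := PowerSeries.HasSubst.of_constantCoeff_zero' hp0
  have hs' := PowerSeries.HasSubst.substInvOfIsUnit p hp1
  let e : f⟦X⟧ ≃ₐ[f] f⟦X⟧ := AlgEquiv.ofAlgHom
    (PowerSeries.substAlgHom hs) (PowerSeries.substAlgHom hs')
    (by
      ext1 h
      rw [AlgHom.comp_apply, PowerSeries.coe_substAlgHom, PowerSeries.coe_substAlgHom,
        PowerSeries.subst_comp_subst_apply hs' hs, PowerSeries.subst_substInvOfIsUnit_left p hp0]
      exact PowerSeries.X_subst h)
    (by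
      ext1 h
      rw [AlgHom.comp_apply, PowerSeries.coe_substAlgHom, PowerSeries.coe_substAlgHom,
        PowerSeries.subst_comp_subst_apply hs hs', PowerSeries.subst_substInvOfIsUnit_right p hp0]
      exact PowerSeries.X_subst h)
  have he : e X = p := by
    change PowerSeries.substAlgHom hs X = p
    rw [PowerSeries.coe_substAlgHom, PowerSeries.subst_X hs]
  let ρ : f⸨X⸩ ≃+* f⸨X⸩ := IsFractionRing.ringEquivOfRingEquiv (A := f⟦X⟧) (B := f⟦X⟧) e.toRingEquiv
  have hρ : ∀ h : f⟦X⟧, ρ (HahnSeries.ofPowerSeries ℤ f h) = HahnSeries.ofPowerSeries ℤ f (e h) :=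
    fun h => IsFractionRing.ringEquivOfRingEquiv_algebraMap e.toRingEquiv h
  let g : G₀ f := AlgEquiv.ofRingEquiv (f := ρ) fun c => by
    rw [HahnSeries.algebraMap_apply', hρ, AlgEquiv.commutes]
  have hg : res f g X = p := ofPS_inj (by
    rw [coe_res, ← he]
    exact hρ X)
  refine ⟨g, mem_G.2 ⟨C a, ?_⟩, 0, ?_⟩ <;> rw [hg, hp] <;> ring

theorem exists_factor {k : ℕ} (hk : 1 ≤ k) {g : G₀ f} (hg : g ∈ G f k) :
    ∃ u v : f⟦X⟧, res f g X = X * u ∧ u * v = 1 ∧ constantCoeff u = 1 ∧ constantCoeff v = 1 ∧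
      constantCoeff (PowerSeries.derivative f (res f g X)) = 1 := by
  obtain ⟨h, hh⟩ := mem_G.1 hg
  have hu : constantCoeff (1 + X ^ k * h) = 1 := by
    have : constantCoeff ((X : f⟦X⟧) ^ k) = 0 := by simp; omega
    simp [this]
  obtain ⟨v, hv⟩ := (PowerSeries.isUnit_iff_constantCoeff.2
    (by rw [hu]; exact isUnit_one)).exists_right_inv
  have he : res f g X = X * (1 + X ^ k * h) := by
    linear_combination hh
  refine ⟨1 + X ^ k * h, v, he, hv, hu, ?_, ?_⟩
  · have := congrArg constantCoeff hv
    rwa [map_mul, hu, one_mul, map_one] at this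
  · rw [he, Derivation.leibniz, PowerSeries.derivative_X, map_add, smul_eq_mul, smul_eq_mul,
      mul_one, map_mul, hu]
    simp

theorem constantCoeff_res {k : ℕ} {g : G₀ f} (hg : g ∈ G f k) (h : f⟦X⟧) :
    constantCoeff (res f g h) = constantCoeff h := by
  have := (dvd_pow_self _ (Nat.succ_ne_zero k)).trans (X_pow_dvd_res_sub hg h)
  rwa [PowerSeries.X_dvd_iff, map_sub, sub_eq_zero] at this

end Automorphisms

/-! ### Coordinates of linear forms -/

section Coordinates

variable {f : Type*} [Field f]

/-- The class in `L_{MN}` of an element of `L_M`. -/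
def toLq (M N : ℕ) : L f M →ₗ[f] Lq f M N := (LIdeal f M N).toSubmodule.mkQ

theorem toLq_eq_zero {M N : ℕ} {D : L f M} (h : (D : W₁ f) ∈ L f N) : toLq M N D = 0 :=
  (Submodule.Quotient.mk_eq_zero _).2 h

theorem toLq_surjective (M N : ℕ) : Function.Surjective (toLq (f := f) M N) :=
  Submodule.mkQ_surjective _

theorem lq_of_le {M i : ℕ} (N : ℕ) (h : M ≤ i) : lq f M N i = toLq M N ⟨l f i, l_mem h⟩ := by
  rw [lq, dif_pos h]
  rfl

theorem lq_of_lt {M i : ℕ} (N : ℕ) (h : i < M) : lq f M N i = 0 := dif_neg (by omega)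

theorem lq_of_ge {M N i : ℕ} (h : N ≤ i) : lq f M N i = 0 := by
  rcases le_or_gt M i with hM | hM
  · rw [lq_of_le N hM]
    exact toLq_eq_zero (l_mem h)
  · exact lq_of_lt N hM

theorem toLq_eq_sum {M : ℕ} (N : ℕ) (D : L f M) :
    toLq M N D = ∑ i ∈ Finset.range N, coeff (i + 1) ((D : W₁ f) X) • lq f M N i := by
  have hl : ∀ i, ∃ E : L f M, lq f M N i = toLq M N E ∧
      (E : W₁ f) X = if M ≤ i then X ^ (i + 1) else 0 := by
    intro i
    by_cases h : M ≤ i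
    · exact ⟨⟨l f i, l_mem h⟩, lq_of_le N h, by rw [if_pos h]; exact l_apply_X i⟩
    · exact ⟨0, by rw [lq_of_lt N (by omega), map_zero], by rw [if_neg h]; rfl⟩
  choose E hE hEX using hl
  simp only [hE]
  simp only [← map_smul, ← map_sum]
  rw [← sub_eq_zero, ← map_sub]
  refine toLq_eq_zero ?_
  rw [mem_L, PowerSeries.X_pow_dvd_iff]
  intro j hj
  have hsum : ((D - ∑ i ∈ Finset.range N, coeff (i + 1) ((D : W₁ f) X) • E i : L f M) : W₁ f) X =
      (D : W₁ f) X - ∑ i ∈ Finset.range N, coeff (i + 1) ((D : W₁ f) X) • ((E i : W₁ f) X) := by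
    let ev : L f M →ₗ[f] f⟦X⟧ :=
      { toFun := fun D => (D : W₁ f) X
        map_add' := fun _ _ => rfl
        map_smul' := fun _ _ => rfl }
    have h := map_sub ev D (∑ i ∈ Finset.range N, coeff (i + 1) ((D : W₁ f) X) • E i)
    rw [map_sum] at h
    simp only [map_smul] at h
    exact h
  have hD := PowerSeries.X_pow_dvd_iff.1 (mem_L.1 D.2)
  rw [hsum, map_sub, map_sum, sub_eq_zero]
  rcases j with _ | j
  · rw [hD 0 (Nat.succ_pos M), Finset.sum_eq_zero]
    intro i _
    rw [hEX]
    split_ifs <;> simp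
  · rw [Finset.sum_eq_single j]
    · rw [hEX]
      split_ifs with h
      · simp
      · rw [hD (j + 1) (by omega)]
        simp
    · intro i _ hi
      rw [hEX]
      split_ifs
      · rw [PowerSeries.coeff_smul, PowerSeries.coeff_X_pow, if_neg (by omega), smul_zero]
      · simp
    · intro h
      exact absurd (Finset.mem_range.2 (by omega)) h

/-- The coordinates `l_n, l_{n-1}, …` of a linear form on `L_{M,n+1}`. -/
def coords {M n : ℕ} (φ : Module.Dual f (Lq f M (n + 1))) (k : ℕ) : f :=
  φ (lq f M (n + 1) (n - k))

variable {M n : ℕ}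

/-- This includes `k > n`, where truncated subtraction yields the index `0`, which is below `M`. -/
theorem coords_eq_zero (hM : 1 ≤ M) (φ : Module.Dual f (Lq f M (n + 1))) {k : ℕ} (h : n < M + k) :
    coords φ k = 0 := by
  rw [coords, lq_of_lt _ (by omega), map_zero]

theorem dual_ext (hM : 1 ≤ M) {φ ψ : Module.Dual f (Lq f M (n + 1))}
    (h : ∀ k, M + k ≤ n → coords φ k = coords ψ k) : φ = ψ := by
  ext x
  obtain ⟨D, rfl⟩ := toLq_surjective M (n + 1) x
  rw [toLq_eq_sum, map_sum, map_sum]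
  refine Finset.sum_congr rfl fun i hi => ?_
  have hi := Finset.mem_range.1 hi
  rw [map_smul, map_smul]
  congr 1
  rcases le_or_gt M i with hMi | hMi
  · have := h (n - i) (by omega)
    rwa [coords, coords, show n - (n - i) = i by omega] at this
  · rw [lq_of_lt _ hMi, map_zero, map_zero]

theorem exists_dual (x : ℕ → f) :
    ∃ φ : Module.Dual f (Lq f M (n + 1)), ∀ k, M + k ≤ n → coords φ k = x k := by
  let ev : L f M →ₗ[f] f :=
    { toFun := fun D => ∑ i ∈ Finset.range (n + 1), coeff (i + 1) ((D : W₁ f) X) * x (n - i)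
      map_add' := fun D E => by
        rw [← Finset.sum_add_distrib]
        refine Finset.sum_congr rfl fun i _ => ?_
        rw [← add_mul]
        rfl
      map_smul' := fun c D => by
        rw [smul_eq_mul, Finset.mul_sum]
        refine Finset.sum_congr rfl fun i _ => ?_
        rw [← mul_assoc]
        rfl }
  have hev : (LIdeal f M (n + 1)).toSubmodule ≤ LinearMap.ker ev := by
    intro D hD
    change ∑ i ∈ Finset.range (n + 1), coeff (i + 1) ((D : W₁ f) X) * x (n - i) = 0
    refine Finset.sum_eq_zero fun i hi => ?_
    have hi := Finset.mem_range.1 hi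
    rw [PowerSeries.X_pow_dvd_iff.1 (mem_L.1 hD) (i + 1) (by omega), zero_mul]
  refine ⟨(LIdeal f M (n + 1)).toSubmodule.liftQ ev hev, fun k hk => ?_⟩
  rw [coords, lq_of_le _ (by omega : M ≤ n - k), toLq, Submodule.mkQ_apply,
    Submodule.liftQ_apply]
  change ∑ i ∈ Finset.range (n + 1), coeff (i + 1) (l f (n - k) X) * x (n - i) = x k
  rw [Finset.sum_eq_single (n - k)]
  · rw [l_apply_X, PowerSeries.coeff_X_pow_self, one_mul, show n - (n - k) = k by omega]
  · intro i _ hi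
    rw [l_apply_X, PowerSeries.coeff_X_pow, if_neg (by omega), zero_mul]
  · intro h
    exact absurd (Finset.mem_range.2 (by omega)) h

/-- The residue pairing of a quadratic differential with a vector field. -/
theorem dual_toLq (φ : Module.Dual f (Lq f M (n + 1))) (D : L f M) :
    φ (toLq M (n + 1) D) = coeff (n + 1) (PowerSeries.mk (coords φ) * (D : W₁ f) X) := by
  rw [toLq_eq_sum, map_sum, PowerSeries.coeff_mul, Finset.Nat.sum_antidiagonal_succ',
    PowerSeries.X_pow_dvd_iff.1 (mem_L.1 D.2) 0 (Nat.succ_pos M), mul_zero, zero_add,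
    ← Finset.Nat.sum_antidiagonal_swap,
    Finset.Nat.sum_antidiagonal_eq_sum_range_succ_mk]
  refine Finset.sum_congr rfl fun i hi => ?_
  have := Finset.mem_range.1 hi
  simp only [Prod.swap, PowerSeries.coeff_mk, coords, map_smul, smul_eq_mul]
  rw [show n - (n - i) = i by omega, mul_comm]

/-- A linear form with vanishing coordinates `l_j`, `j > p`, vanishes on `L_{p+1}`. -/
theorem dual_toLq_eq_zero {p : ℕ} {φ : Module.Dual f (Lq f M (n + 1))}
    (h : ∀ j, p < j → φ (lq f M (n + 1) j) = 0) {D : L f M} (hD : (D : W₁ f) ∈ L f (p + 1)) :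
    φ (toLq M (n + 1) D) = 0 := by
  rw [toLq_eq_sum, map_sum]
  refine Finset.sum_eq_zero fun i _ => ?_
  rw [map_smul]
  rcases le_or_gt i p with hi | hi
  · rw [PowerSeries.X_pow_dvd_iff.1 (mem_L.1 hD) (i + 1) (by omega), zero_smul]
  · rw [h i hi, smul_zero]

theorem dual_ext_toLq {N : ℕ} {φ ψ : Module.Dual f (Lq f M N)}
    (h : ∀ D, φ (toLq M N D) = ψ (toLq M N D)) : φ = ψ := by
  ext x
  obtain ⟨D, rfl⟩ := toLq_surjective M N x
  exact h D

end Coordinates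

/-! ### Inclusions of the dual spaces, evaluated on representatives -/

section Inclusions

variable {f : Type*} [Field f]

theorem incl_toLq {M n i : ℕ} (h : n ≤ i) (φ : Module.Dual f (Lq f M n)) (D : L f M) :
    incl M h φ (toLq M i D) = φ (toLq M n D) := rfl

theorem inclStar_apply {M n : ℕ} (φ : Module.Dual f (Lq f M n)) (D : L f M) :
    (inclStar M n φ : Module.Dual f (L f M)) D = φ (toLq M n D) := rfl

end Inclusions

/-! ### Orbits at different levels -/

section Orbits

variable {f : Type*} [Field f] [CharZero f]

/-- The orbit of a linear form `φ` under the co-adjoint action of `G_{MN}`. -/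
def orbit {M N : ℕ} (φ : Module.Dual f (Lq f M N)) : Set (Module.Dual f (Lq f M N)) :=
  {ψ | ∃ g : G f M, ∀ D : L f M, ψ (toLq M N D) = φ (toLq M N (Ad f M g D))}

theorem coad_toLq {M N : ℕ} (φ : Module.Dual f (Lq f M N)) (g : G f M) (D : L f M) :
    coad f M N (QuotientGroup.mk g) φ (toLq M N D) = φ (toLq M N (Ad f M g⁻¹ D)) := rfl

theorem coadStar_apply {M : ℕ} (φ : Lstar f M) (g : G f M) (D : L f M) :
    (coadStar f M g φ : Module.Dual f (L f M)) D =
      (φ : Module.Dual f (L f M)) (Ad f M g⁻¹ D) := rfl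

theorem exists_translate {M : ℕ} (N : ℕ) (φ : Module.Dual f (Lq f M N)) (g : G f M) :
    ∃ ψ : Module.Dual f (Lq f M N), ∀ D, ψ (toLq M N D) = φ (toLq M N (Ad f M g D)) :=
  ⟨coad f M N (QuotientGroup.mk g⁻¹) φ, fun D => by rw [coad_toLq, inv_inv]⟩

/-- Acting by lifts to `G_M`, and by `g` instead of `g⁻¹`, leaves the orbit unchanged and puts all
levels under one group. -/
theorem range_coad {M N : ℕ} (φ : Module.Dual f (Lq f M N)) :
    (Set.range fun g : Gq f M N => coad f M N g φ) = orbit φ := by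
  ext ψ
  constructor
  · rintro ⟨q, rfl⟩
    obtain ⟨g, rfl⟩ := QuotientGroup.mk_surjective q
    exact ⟨g⁻¹, fun D => coad_toLq φ g D⟩
  · rintro ⟨g, hg⟩
    exact ⟨QuotientGroup.mk g⁻¹, dual_ext_toLq fun D => by rw [hg, coad_toLq, inv_inv]⟩

theorem isOrbit_iff {M N : ℕ} {O : Set (Module.Dual f (Lq f M N))} :
    IsOrbit (coad f M N) O ↔ ∃ φ, O = orbit φ := by
  simp only [IsOrbit, range_coad]

theorem self_mem_orbit {M N : ℕ} (φ : Module.Dual f (Lq f M N)) : φ ∈ orbit φ :=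
  ⟨1, fun D => by rw [map_one]; rfl⟩

theorem orbit_trans {M N : ℕ} {φ ψ χ : Module.Dual f (Lq f M N)} (h : ψ ∈ orbit φ)
    (h' : χ ∈ orbit ψ) : χ ∈ orbit φ := by
  obtain ⟨g, hg⟩ := h
  obtain ⟨g', hg'⟩ := h'
  exact ⟨g * g', fun D => by rw [hg', hg, map_mul]; rfl⟩

/-- The projections between levels commute with `G_M`, so an orbit remains an orbit at every higher
level. -/
theorem image_incl_orbit {M n i : ℕ} (h : n ≤ i) (φ : Module.Dual f (Lq f M n)) :
    incl M h '' orbit φ = orbit (incl M h φ) := by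
  ext ψ
  constructor
  · rintro ⟨χ, ⟨g, hg⟩, rfl⟩
    exact ⟨g, fun D => by rw [incl_toLq, incl_toLq, hg]⟩
  · rintro ⟨g, hg⟩
    obtain ⟨χ, hχ⟩ := exists_translate n φ g
    exact ⟨χ, ⟨g, hχ⟩, dual_ext_toLq fun D => by rw [hg, incl_toLq, incl_toLq, hχ]⟩

theorem image_inclStar_orbit {M n : ℕ} (φ : Module.Dual f (Lq f M n)) :
    inclStar M n '' orbit φ = Set.range fun g : G f M => coadStar f M g (inclStar M n φ) := by
  ext ψ
  constructor
  · rintro ⟨χ, ⟨g, hg⟩, rfl⟩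
    refine ⟨g⁻¹, Subtype.ext (LinearMap.ext fun D => ?_)⟩
    rw [inclStar_apply, hg, coadStar_apply, inclStar_apply, inv_inv]
  · rintro ⟨g, rfl⟩
    obtain ⟨χ, hχ⟩ := exists_translate n φ g⁻¹
    refine ⟨χ, ⟨g⁻¹, hχ⟩, Subtype.ext (LinearMap.ext fun D => ?_)⟩
    rw [inclStar_apply, hχ, coadStar_apply, inclStar_apply]

end Orbits

/-! ### The co-adjoint action in coordinates and its invariants -/

section Action

variable {f : Type*} [Field f] [CharZero f] {m n : ℕ}

theorem coe_Ad {M : ℕ} (g : G f M) (D : L f M) :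
    ((Ad f M g D : L f M) : W₁ f) = conj (res f (g : G₀ f)) D := rfl

theorem translate_lq {M N : ℕ} {φ ψ : Module.Dual f (Lq f M N)} {g : G f M}
    (hψ : ∀ D, ψ (toLq M N D) = φ (toLq M N (Ad f M g D))) {k i : ℕ} (hk : 1 ≤ k) (hi : M ≤ i)
    {a : f} (ha : (X : f⟦X⟧) ^ (k + 2) ∣ res f (g : G₀ f) X - X - C a * X ^ (k + 1)) :
    ∃ E : L f M, (E : W₁ f) ∈ L f (i + k + 1) ∧
      ψ (lq f M N i) = φ (lq f M N i) + ((i : f) - k) * a * φ (lq f M N (i + k)) +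
        φ (toLq M N E) := by
  refine ⟨Ad f M g ⟨l f i, l_mem hi⟩ - ⟨l f i, l_mem hi⟩ -
    (((i : f) - k) * a) • ⟨l f (i + k), l_mem (by omega)⟩, ?_, ?_⟩
  · have hc : ∀ (c : f) (A B D : L f M),
        ((A - B - c • D : L f M) : W₁ f) = (A : W₁ f) - B - c • (D : W₁ f) :=
      fun _ _ _ _ => rfl
    rw [hc, coe_Ad]
    exact conj_l_sub_mem hk ha
  · have key : ∀ (Λ : L f M →ₗ[f] f) (c : f) (A B D : L f M),
        Λ A = Λ B + c * Λ D + Λ (A - B - c • D) := fun Λ c A B D => by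
      rw [map_sub, map_sub, map_smul, smul_eq_mul]
      ring
    rw [lq_of_le N hi, lq_of_le N (by omega : M ≤ i + k), hψ]
    exact key (φ ∘ₗ toLq M N) _ _ _ _

/-- An element of `G_{m+1}` changes `l_{n-k}` by an element of `L_{n-k+m+1}`, which lies in
`L_{n+1}` for `k ≤ m`. -/
theorem coords_eq_of_mem_orbit {φ ψ : Module.Dual f (Lq f (m + 1) (n + 1))} (h : ψ ∈ orbit φ)
    {k : ℕ} (hk : k ≤ m) : coords ψ k = coords φ k := by
  rcases lt_or_ge n (m + 1 + k) with hn | hn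
  · rw [coords_eq_zero (by omega) _ hn, coords_eq_zero (by omega) _ hn]
  obtain ⟨g, hg⟩ := h
  obtain ⟨a, ha⟩ := exists_leading_coeff g.2
  obtain ⟨E, hE, h⟩ := translate_lq (i := n - k) hg (by omega) (by omega) ha
  rw [coords, h, lq_of_ge (i := n - k + (m + 1)) (by omega),
    toLq_eq_zero (L_antitone (by omega) hE)]
  simp [coords]

/-- The only possible change of this coordinate is a multiple of the leading one. -/
theorem coords_succ_eq_of_mem_orbit {φ ψ : Module.Dual f (Lq f (m + 1) (n + 1))} (h : ψ ∈ orbit φ)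
    (h0 : coords φ 0 = 0) : coords ψ (m + 1) = coords φ (m + 1) := by
  rcases lt_or_ge n (m + 1 + (m + 1)) with hn | hn
  · rw [coords_eq_zero (by omega) _ hn, coords_eq_zero (by omega) _ hn]
  obtain ⟨g, hg⟩ := h
  obtain ⟨a, ha⟩ := exists_leading_coeff g.2
  obtain ⟨E, hE, h⟩ := translate_lq (i := n - (m + 1)) hg (by omega) (by omega) ha
  rw [coords, h, show n - (m + 1) + (m + 1) = n - 0 by omega, ← coords, ← coords, h0,
    toLq_eq_zero (L_antitone (by omega) hE)]
  simp

/-- Modulo `L_{2m+3}` the group could only move `l_{m+1}`, by a multiple of `l_{2m+2}`; the factor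
`i - k` vanishes there because `i = k = m + 1`. -/
theorem orbit_eq_singleton {N : ℕ} {φ : Module.Dual f (Lq f (m + 1) (N + 1))}
    (h : ∀ j, 2 * m + 2 < j → φ (lq f (m + 1) (N + 1) j) = 0) : orbit φ = {φ} := by
  refine Set.eq_singleton_iff_unique_mem.2 ⟨self_mem_orbit φ, ?_⟩
  rintro ψ ⟨g, hg⟩
  obtain ⟨a, ha⟩ := exists_leading_coeff g.2
  refine dual_ext (by omega) fun k hk => ?_
  obtain ⟨E, hE, h'⟩ := translate_lq (i := N - k) hg (by omega) (by omega) ha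
  rw [coords, h', dual_toLq_eq_zero h (L_antitone (by omega) hE), ← coords]
  rcases eq_or_ne (N - k) (m + 1) with e | e
  · rw [e]
    simp
  · rw [h _ (by omega)]
    simp

theorem exists_mem_orbit_coords {φ : Module.Dual f (Lq f (m + 1) (n + 1))} (h0 : coords φ 0 ≠ 0)
    {k : ℕ} (hk : m + 1 ≤ k) (hkn : m + 1 + k ≤ n) (hne : n ≠ 2 * k) (c : f) :
    ∃ ψ ∈ orbit φ, (∀ j < k, coords ψ j = coords φ j) ∧ coords ψ k = c := by
  have hd : ((n - k : ℕ) : f) - k ≠ 0 := by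
    rw [sub_ne_zero]
    exact_mod_cast (by omega : n - k ≠ k)
  -- The parameter `a` solves `x_k + (n - 2k) a x_0 = c`.
  obtain ⟨g, hg, ha⟩ := exists_mem_G (f := f) (k := k) (by omega)
    ((c - coords φ k) / ((((n - k : ℕ) : f) - k) * coords φ 0))
  have hgm : g ∈ G f (m + 1) := by
    rw [mem_G] at hg ⊢
    exact (pow_dvd_pow _ (by omega)).trans hg
  obtain ⟨ψ, hψ⟩ := exists_translate (n + 1) φ ⟨g, hgm⟩
  refine ⟨ψ, ⟨_, hψ⟩, fun j hj => ?_, ?_⟩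
  · obtain ⟨E, hE, h⟩ := translate_lq (i := n - j) hψ (by omega) (by omega) ha
    rw [coords, h, lq_of_ge (i := n - j + k) (by omega), toLq_eq_zero (L_antitone (by omega) hE)]
    simp [coords]
  · obtain ⟨E, hE, h⟩ := translate_lq (i := n - k) hψ (by omega) (by omega) ha
    rw [coords, h, toLq_eq_zero (L_antitone (by omega) hE), map_zero, add_zero,
      show n - k + k = n - 0 by omega, ← coords, ← coords]
    field_simp
    ring

/-- The transformation rule of quadratic differentials for `τ = g⁻¹`: one factor `τ'` comes from the
vector field, the other from `dt` in the invariance of the residue, and `y^(n+2)` from the pole. -/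
theorem coords_translate {M : ℕ} (hM : 1 ≤ M) {φ ψ : Module.Dual f (Lq f M (n + 1))} {g : G f M}
    (hψ : ∀ D, ψ (toLq M (n + 1) D) = φ (toLq M (n + 1) (Ad f M g D))) {w y : f⟦X⟧}
    (hw : res f (g : G₀ f)⁻¹ X = X * w) (hwy : w * y = 1) {k : ℕ} (hk : M + k ≤ n) :
    coords ψ k = coeff k (res f (g : G₀ f)⁻¹ (PowerSeries.mk (coords φ)) *
      PowerSeries.derivative f (res f (g : G₀ f)⁻¹ X) ^ 2 * y ^ (n + 2)) := by
  rw [coords, lq_of_le _ (by omega : M ≤ n - k), hψ, dual_toLq,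
    ← coeff_map_mul_derivative (res f (g : G₀ f)⁻¹) hw hwy (n + 1),
    map_mul (res f (g : G₀ f)⁻¹)]
  have e : res f (g : G₀ f)⁻¹ (((Ad f M g ⟨l f (n - k), l_mem (by omega)⟩ : L f M) : W₁ f) X) =
      PowerSeries.derivative f (res f (g : G₀ f)⁻¹ X) * X ^ (n - k + 1) := by
    have := symm_conj_X (res f (g : G₀ f)) (l f (n - k))
    rw [res_symm, l_apply_X] at this
    exact this
  rw [e]
  have e' : ∀ A B : f⟦X⟧, A * (B * X ^ (n - k + 1)) * B * y ^ (n + 1 + 1) =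
      X ^ (n - k + 1) * (A * B ^ 2 * y ^ (n + 2)) := fun A B => by ring
  rw [e', PowerSeries.coeff_X_pow_mul', if_pos (by omega), show n + 1 - (n - k + 1) = k by omega]

theorem sqrtCoeff_eq_of_mem_orbit {M p : ℕ} (hM : 1 ≤ M)
    {φ ψ : Module.Dual f (Lq f M (2 * p + 1))} (h : ψ ∈ orbit φ) (hp : M ≤ p)
    (h0 : coords φ 0 ≠ 0) : sqrtCoeff (coords ψ) p = sqrtCoeff (coords φ) p := by
  obtain ⟨g, hg⟩ := h
  obtain ⟨w, y, hw, hwy, hw1, hy1, hd1⟩ := exists_factor hM (inv_mem g.2)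
  have hc := fun k hk => coords_translate (n := 2 * p) hM hg hw hwy (k := k) hk
  set τ := res f (g : G₀ f)⁻¹
  have hτ : ∀ h, constantCoeff (τ h) = constantCoeff h := constantCoeff_res (inv_mem g.2)
  set δ := PowerSeries.derivative f (τ X)
  set S := normSeries (coords φ 0) (coords φ)
  have hS : constantCoeff S = 1 := constantCoeff_normSeries _ _
  have hmk : PowerSeries.mk (coords φ) = C (coords φ 0) * S := by
    ext k
    rw [PowerSeries.coeff_C_mul, PowerSeries.coeff_mk,
      show coeff k S = if k = 0 then 1 else (coords φ 0)⁻¹ • coords φ k from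
        PowerSeries.coeff_mk _ _]
    split_ifs with hk
    · rw [hk, mul_one]
    · rw [smul_eq_mul, mul_inv_cancel_left₀ h0]
  have hT1 : constantCoeff (τ (sqrtSeries S) * δ * y ^ (p + 1)) = 1 := by
    rw [map_mul, map_mul, map_pow, hτ, constantCoeff_sqrtSeries hS, hd1, hy1]
    simp
  -- The pole order `n + 2 = 2(p + 1)` is even, so the transformed differential is again a square:
  -- that of the transformed 1-form.
  have hTT : τ (sqrtSeries S) * δ * y ^ (p + 1) * (τ (sqrtSeries S) * δ * y ^ (p + 1)) =
      τ S * δ ^ 2 * y ^ (2 * p + 2) := by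
    have : τ S = τ (sqrtSeries S) * τ (sqrtSeries S) := by
      rw [← map_mul, sqrtSeries_mul_self hS]
    rw [this]
    ring
  have hc' : ∀ k, M + k ≤ 2 * p →
      coords ψ k = coords φ 0 * coeff k (τ S * δ ^ 2 * y ^ (2 * p + 2)) := fun k hk => by
    have hC : τ (C (coords φ 0)) = C (coords φ 0) := τ.commutes _
    rw [hc k hk, hmk, map_mul τ, hC, mul_assoc (C _), mul_assoc (C _), PowerSeries.coeff_C_mul]
  have hψ0 : coords ψ 0 = coords φ 0 := by
    rw [hc' 0 (by omega), ← hTT, PowerSeries.coeff_zero_eq_constantCoeff_apply, map_mul, hT1]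
    ring
  have hR : constantCoeff (τ S * δ ^ 2 * y ^ (2 * p + 2)) = 1 := by
    rw [← hTT, map_mul, hT1, mul_one]
  -- Only the coefficients up to `p` matter, and `M ≤ p` keeps them below the truncation at `2p -
  -- M`.
  have hnorm : ∀ k ≤ p, coeff k (normSeries (coords ψ 0) (coords ψ)) =
      coeff k (τ S * δ ^ 2 * y ^ (2 * p + 2)) := by
    intro k hk
    rw [normSeries, PowerSeries.coeff_mk]
    split_ifs with hk0
    · rw [hk0, PowerSeries.coeff_zero_eq_constantCoeff_apply, hR]
    · rw [hψ0, hc' k (by omega), smul_eq_mul, inv_mul_cancel_left₀ h0]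
  have key := coeff_sqrtSeries_sub (constantCoeff_normSeries (coords ψ 0) (coords ψ)) hR (N := p)
    fun k hk => hnorm k hk.le
  rw [hnorm p le_rfl, sub_self, sqrtSeries_eq hR hT1 hTT,
    coeff_map_mul_derivative τ hw hwy p (sqrtSeries S), eq_comm, mul_eq_zero, sub_eq_zero] at key
  exact key.resolve_left two_ne_zero

/-- The orbits of linear forms with nonzero leading coordinate. -/
theorem mem_orbit_iff (hn : 2 * m + 2 < n) {φ ψ : Module.Dual f (Lq f (m + 1) (n + 1))}
    (h0 : coords φ 0 ≠ 0) :
    ψ ∈ orbit φ ↔ (∀ k ≤ m, coords ψ k = coords φ k) ∧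
      ∀ p, n = 2 * p → sqrtCoeff (coords ψ) p = sqrtCoeff (coords φ) p := by
  constructor
  · intro h
    refine ⟨fun k hk => coords_eq_of_mem_orbit h hk, ?_⟩
    rintro p rfl
    exact sqrtCoeff_eq_of_mem_orbit (by omega) h (by omega) h0
  rintro ⟨h1, h2⟩
  -- The coordinates of `ψ` are matched one at a time inside the orbit of `φ`. At `k = n/2` no group
  -- element is needed: equality of the invariants and of the lower coordinates forces `x_k` to
  -- agree.
  have key : ∀ d, m + 1 + (m + 1 + d) ≤ n + 1 →
      ∃ χ ∈ orbit φ, ∀ k < m + 1 + d, coords χ k = coords ψ k := by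
    intro d
    induction d with
    | zero => exact fun _ => ⟨φ, self_mem_orbit φ, fun k hk => (h1 k (by omega)).symm⟩
    | succ d ih =>
      intro hd
      obtain ⟨χ, hχ, hχk⟩ := ih (by omega)
      have hχ0 : coords χ 0 ≠ 0 := by rwa [coords_eq_of_mem_orbit hχ (by omega)]
      by_cases hne : n = 2 * (m + 1 + d)
      · refine ⟨χ, hχ, fun k hk => ?_⟩
        rcases Nat.lt_succ_iff_lt_or_eq.1 hk with hk | rfl
        · exact hχk k hk
        have hs : sqrtCoeff (coords χ) (m + 1 + d) = sqrtCoeff (coords φ) (m + 1 + d) := by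
          subst hne
          exact sqrtCoeff_eq_of_mem_orbit (by omega) hχ (by omega) h0
        have := (sqrtCoeff_sub (x := coords χ) (y := coords ψ) (by omega) hχk).resolve_right hχ0
        rwa [hs, h2 _ hne, sub_self, mul_zero, sub_eq_zero] at this
      · obtain ⟨χ', hχ', h3, h4⟩ := exists_mem_orbit_coords hχ0 (k := m + 1 + d) (by omega)
          (by omega) hne (coords ψ (m + 1 + d))
        refine ⟨χ', orbit_trans hχ hχ', fun k hk => ?_⟩
        rcases Nat.lt_succ_iff_lt_or_eq.1 hk with hk | rfl
        · rw [h3 k hk, hχk k hk]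
        · exact h4
  obtain ⟨χ, hχ, h⟩ := key (n - 2 * m - 1) (by omega)
  rwa [dual_ext (by omega) fun k hk => h k (by omega)] at hχ

end Action

/-! ### Orbits as graphs, and the criterion for general position -/

section GeneralPosition

variable {f : Type*} [Field f] {m n : ℕ}

/-- The indices of the coordinates `l_j, …, l_n` that are free on an orbit in general position. -/
def freeIndices (m n j : ℕ) : Set (Fin (n + 1 - j)) := {r | j + r + m < n ∧ 2 * (j + r : ℕ) ≠ n}

open Classical in
/-- The generic point of an orbit with leading coordinates `x 0, …, x m`. -/
def genericCoords (m n j : ℕ) (x : ℕ → f) (k : ℕ) : MvPolynomial (freeIndices m n j) f :=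
  if k ≤ m then MvPolynomial.C (x k) else
    if h : ∃ r : freeIndices m n j, j + (r : Fin (n + 1 - j)) + k = n then
      MvPolynomial.X h.choose else 0

theorem genericCoords_half {j : ℕ} (x : ℕ → f) {p : ℕ} (hn : n = 2 * p) (hp : m < p) :
    genericCoords m n j x p = 0 := by
  rw [genericCoords, if_neg (by omega), dif_neg]
  rintro ⟨⟨r, hr⟩, hr'⟩
  exact hr.2 (by simp only at hr'; omega)

/-- Since `j ≤ p`, all coordinates `x_k` with `k < p` survive the restriction to `L_{j,n+1}`; hence
the equation for `x_p` involves only visible coordinates. -/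
theorem aeval_genericCoords {j : ℕ} {φ ψ : Module.Dual f (Lq f (m + 1) (n + 1))}
    (h : ∀ k ≤ m, coords ψ k = coords φ k) {p : ℕ} (hn : n = 2 * p) (hj : j ≤ p) {k : ℕ}
    (hk : k < p) :
    MvPolynomial.aeval
      (fun a : freeIndices m n j => ψ (lq f (m + 1) (n + 1) (j + (a : Fin (n + 1 - j)))))
      (genericCoords m n j (coords φ) k) = coords ψ k := by
  rw [genericCoords]
  split_ifs with h1 h2
  · rw [MvPolynomial.aeval_C, h k h1]
    rfl
  · rw [MvPolynomial.aeval_X, coords]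
    have := h2.choose_spec
    congr 2
    omega
  · exact absurd ⟨⟨⟨n - k - j, by omega⟩, ⟨by simp only; omega, by simp only; omega⟩⟩,
      by simp only; omega⟩ h2

variable [CharZero f]

theorem exists_sqrtCoeff_eq (x : ℕ → f) (h0 : x 0 ≠ 0) {p : ℕ} (hp : 0 < p) (e : f) :
    ∃ y : ℕ → f, (∀ k, k ≠ p → y k = x k) ∧ sqrtCoeff y p = e := by
  -- The invariant has slope `1/(2 x_0)` in `x_p`, which dictates the correction.
  set y := Function.update x p (x p + 2 * x 0 * (e - sqrtCoeff x p)) with hy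
  have hne : ∀ k, k ≠ p → y k = x k := fun k hk => by rw [hy, Function.update_of_ne hk]
  have hy0 : y 0 = x 0 := hne 0 hp.ne
  refine ⟨y, hne, ?_⟩
  have h := (sqrtCoeff_sub (x := y) (y := x) hp
    fun k hk => hne k hk.ne).resolve_right (by rwa [hy0])
  rw [hy0, hy, Function.update_self, ← hy, add_sub_cancel_left] at h
  have := mul_left_cancel₀ (mul_ne_zero two_ne_zero h0) h
  linear_combination -this

/-- A linear form with prescribed leading coordinates and, for even `n`, prescribed invariant. -/
theorem exists_dual_sqrtCoeff (hn : 2 * m + 2 < n) (x : ℕ → f) (h0 : x 0 ≠ 0) (e : f) :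
    ∃ ψ : Module.Dual f (Lq f (m + 1) (n + 1)),
      (∀ k, m + 1 + k ≤ n → n ≠ 2 * k → coords ψ k = x k) ∧
      ∀ p, n = 2 * p → sqrtCoeff (coords ψ) p = e := by
  by_cases h : ∃ p, n = 2 * p
  · obtain ⟨p, rfl⟩ := h
    obtain ⟨y, hy, hye⟩ := exists_sqrtCoeff_eq x h0 (p := p) (by omega) e
    obtain ⟨ψ, hψ⟩ := exists_dual (M := m + 1) (n := 2 * p) y
    refine ⟨ψ, fun k hk hkp => ?_, fun q hq => ?_⟩
    · rw [hψ k hk, hy k (by omega)]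
    · obtain rfl : q = p := by omega
      rw [sqrtCoeff_congr fun k hk => hψ k (by omega), hye]
  · obtain ⟨ψ, hψ⟩ := exists_dual (M := m + 1) (n := n) x
    exact ⟨ψ, fun k hk _ => hψ k hk, fun p hp => absurd ⟨p, hp⟩ h⟩

/-- The equations of an orbit with leading coordinates `x 0, …, x m` and invariant `e`. -/
def orbitEquations (m n j : ℕ) (x : ℕ → f) (e : f) (r : Fin (n + 1 - j)) :
    MvPolynomial (freeIndices m n j) f :=
  if n ≤ j + r + m then MvPolynomial.C (x (n - (j + r))) else
    MvPolynomial.C (2 * x 0) * (MvPolynomial.C e -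
      coeff (n / 2) (sqrtSeries (normSeries (x 0) (genericCoords m n j x))))

theorem eq_aeval_orbitEquations (hn : 2 * m + 2 < n) {j : ℕ}
    {φ ψ : Module.Dual f (Lq f (m + 1) (n + 1))} (h0 : coords φ 0 ≠ 0) (h : ψ ∈ orbit φ)
    {r : Fin (n + 1 - j)} (hr : r ∉ freeIndices m n j) :
    ψ (lq f (m + 1) (n + 1) (j + r)) = MvPolynomial.aeval
      (fun a : freeIndices m n j => ψ (lq f (m + 1) (n + 1) (j + (a : Fin (n + 1 - j)))))
      (orbitEquations m n j (coords φ) (sqrtCoeff (coords φ) (n / 2)) r) := by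
  obtain ⟨h1, h2⟩ := (mem_orbit_iff hn h0).1 h
  have hc : ψ (lq f (m + 1) (n + 1) (j + r)) = coords ψ (n - (j + r)) := by
    rw [coords]
    congr 2
    omega
  rw [hc, orbitEquations]
  split_ifs with hjr
  · rw [MvPolynomial.aeval_C, h1 _ (by omega)]
    rfl
  have hnp : n = 2 * (j + r) := by
    by_contra hne
    exact hr ⟨by omega, by omega⟩
  set p : ℕ := j + r
  have hp : n / 2 = p := by omega
  rw [hp, show n - p = p by omega]
  set ev := MvPolynomial.aeval (R := f)
    (fun a : freeIndices m n j => ψ (lq f (m + 1) (n + 1) (j + (a : Fin (n + 1 - j)))))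
  have hev : ev (coeff p (sqrtSeries (normSeries (coords φ 0)
      (genericCoords m n j (coords φ))))) =
      sqrtCoeff (fun k => ev (genericCoords m n j (coords φ) k)) p := by
    have e1 := congrArg (coeff p) (map_sqrtSeries (constantCoeff_normSeries (coords φ 0)
      (genericCoords m n j (coords φ))) (ev : _ →+* f))
    rw [map_normSeries, PowerSeries.coeff_map] at e1
    refine e1.trans ?_
    rw [sqrtCoeff, aeval_genericCoords h1 hnp (by omega) (by omega), h1 0 (by omega)]
  -- Comparison of `ψ` with the sequence that agrees with it below `p` and is `0` at `p` expresses
  -- `x_p` through the invariant and the free coordinates.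
  have key := (sqrtCoeff_sub (x := coords ψ)
    (y := fun k => ev (genericCoords m n j (coords φ) k)) (N := p) (by omega)
    fun k hk => (aeval_genericCoords h1 hnp (by omega) hk).symm).resolve_right
    (by rwa [h1 0 (by omega)])
  rw [genericCoords_half _ hnp (by omega), map_zero, sub_zero, h2 p hnp, h1 0 (by omega)] at key
  rw [key, map_mul, map_sub, hev, MvPolynomial.aeval_C, MvPolynomial.aeval_C]
  rfl

theorem restrictTo_orbit (hn : 2 * m + 2 < n) {j : ℕ} (hj : m + 1 ≤ j)
    {φ : Module.Dual f (Lq f (m + 1) (n + 1))} (h0 : coords φ 0 ≠ 0) :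
    restrictTo j (orbit φ) = graphSet (freeIndices m n j)
      (orbitEquations m n j (coords φ) (sqrtCoeff (coords φ) (n / 2))) := by
  refine eq_graphSet ?_ fun x => ?_
  · rintro _ ⟨ψ, hψ, rfl⟩ r hr
    exact eq_aeval_orbitEquations hn h0 hψ hr
  -- The free coordinates are taken from `x`; those outside the restriction get the value `0`, and
  -- the invariant fixes the middle one.
  · obtain ⟨ψ, h1, h2⟩ := exists_dual_sqrtCoeff hn
      (fun k => if k ≤ m then coords φ k else
        if h : n - k - j < n + 1 - j then x ⟨n - k - j, h⟩ else 0)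
      (by simpa using h0) (sqrtCoeff (coords φ) (n / 2))
    refine ⟨_, ⟨ψ, (mem_orbit_iff hn h0).2 ⟨fun k hk => ?_, fun p hp => ?_⟩, rfl⟩, ?_⟩
    · rw [h1 k (by omega) (by omega), if_pos hk]
    · rw [h2 p hp, show n / 2 = p by omega]
    · rintro r ⟨hr1, hr2⟩
      have := h1 (n - (j + r)) (by omega) (by omega)
      rw [coords, show n - (n - (j + r)) = j + r by omega, if_neg (by omega),
        dif_pos (by omega)] at this
      simp only
      rw [this]
      congr 1
      ext
      simp only
      omega

theorem ncard_freeIndices_even (hn : 2 * m + 2 < n) (he : Even n) :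
    (freeIndices m n (m + 1)).ncard = n - 2 * m - 2 := by
  obtain ⟨p, hp⟩ := he
  rw [← Set.ncard_image_of_injective _ Fin.val_injective]
  -- The erased index is that of `l_{n/2}`.
  have : (Fin.val '' freeIndices m n (m + 1)) =
      ((Finset.range (n - 2 * m - 1)).erase (p - m - 1) : Finset ℕ) := by
    ext k
    simp only [freeIndices, Set.mem_image, Set.mem_ofPred_eq, Finset.coe_erase, Set.mem_sdiff,
      Finset.coe_range, Set.mem_Iio, Set.mem_singleton_iff]
    constructor
    · rintro ⟨r, ⟨h1, h2⟩, rfl⟩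
      omega
    · rintro ⟨h1, h2⟩
      exact ⟨⟨k, by omega⟩, ⟨by simp only; omega, by simp only; omega⟩, rfl⟩
  rw [this, Set.ncard_coe_finset, Finset.card_erase_of_mem (Finset.mem_range.2 (by omega)),
    Finset.card_range]
  omega

/-- The orbits of forms with vanishing leading coordinate are smaller than the others. -/
theorem restrictTo_orbit_subset {j : ℕ} {φ : Module.Dual f (Lq f (m + 1) (n + 1))}
    (h0 : coords φ 0 = 0) :
    restrictTo j (orbit φ) ⊆ graphSet {r : Fin (n + 1 - j) | j + r + m + 1 < n}
      fun r => MvPolynomial.C (coords φ (n - (j + r))) := by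
  rintro _ ⟨ψ, hψ, rfl⟩ r hr
  have hr' : ¬ (j + (r : ℕ) + m + 1 < n) := hr
  have hc : ψ (lq f (m + 1) (n + 1) (j + r)) = coords ψ (n - (j + r)) := by
    rw [coords]
    congr 2
    omega
  simp only [MvPolynomial.aeval_C, hc]
  rcases Nat.lt_succ_iff_lt_or_eq.1 (show n - (j + (r : ℕ)) < m + 2 by omega) with h | h
  · exact coords_eq_of_mem_orbit hψ (by omega)
  · rw [h]
    exact coords_succ_eq_of_mem_orbit hψ h0

theorem ncard_le_ncard_freeIndices (m n j : ℕ) :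
    {r : Fin (n + 1 - j) | j + r + m + 1 < n}.ncard ≤ (freeIndices m n j).ncard := by
  classical
  -- Indices from `n/2` upwards are shifted by one, so that the forbidden middle index is skipped;
  -- the gap `m + 1` on the left leaves room for the shift. The bound `r + 1 < n + 1 - j` always
  -- holds here and only serves to form the element of `Fin`.
  refine Set.ncard_le_ncard_of_injOn
    (fun r => if h : n ≤ 2 * (j + r) ∧ r + 1 < n + 1 - j then ⟨r + 1, h.2⟩ else r) ?_ ?_
  · intro r (hr : j + (r : ℕ) + m + 1 < n)
    split_ifs with h
    · exact ⟨by simp only; omega, by simp only; omega⟩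
    · exact ⟨by omega, by omega⟩
  · intro r (hr : j + (r : ℕ) + m + 1 < n) s (hs : j + (s : ℕ) + m + 1 < n) hrs
    have := congrArg Fin.val hrs
    ext
    dsimp only at this
    split_ifs at this <;> (try dsimp only at this) <;> omega

theorem zariskiDim_restrictTo_orbit (hn : 2 * m + 2 < n) {j : ℕ} (hj : m + 1 ≤ j)
    {φ : Module.Dual f (Lq f (m + 1) (n + 1))} (h0 : coords φ 0 ≠ 0) :
    zariskiDim (restrictTo j (orbit φ)) = ((freeIndices m n j).ncard : WithBot ℕ∞) := by
  rw [restrictTo_orbit hn hj h0, zariskiDim_graphSet]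

theorem inGeneralPosition_iff (hn : 2 * m + 2 < n)
    {φ : Module.Dual f (Lq f (m + 1) (n + 1))} :
    InGeneralPosition (m + 1) (n + 1) (orbit φ) ↔ coords φ 0 ≠ 0 := by
  constructor
  · intro h h0
    obtain ⟨ψ, hψ⟩ := exists_dual (f := f) (M := m + 1) (n := n) fun _ => 1
    have hψ0 : coords ψ 0 ≠ 0 := by
      rw [hψ 0 (by omega)]
      exact one_ne_zero
    -- The restriction to `l_{n-m-1}, …, l_n` detects the leading coordinate: if it vanishes the
    -- image is a point, otherwise `l_{n-m-1}` is free.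
    have hle := h.2 (n - m - 1) (by omega) (by omega) _ (isOrbit_iff.2 ⟨ψ, rfl⟩)
    rw [zariskiDim_restrictTo_orbit hn (by omega) hψ0] at hle
    have hle' := hle.trans (zariskiDim_mono (restrictTo_orbit_subset h0))
    rw [zariskiDim_graphSet] at hle'
    have hempty : {r : Fin (n + 1 - (n - m - 1)) | n - m - 1 + r + m + 1 < n} = ∅ := by
      ext r
      simp only [Set.mem_ofPred_eq, Set.mem_empty_iff_false, iff_false]
      omega
    rw [hempty, Set.ncard_empty] at hle'
    have hcard : (freeIndices m n (n - m - 1)).ncard ≤ 0 := by exact_mod_cast hle'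
    rw [Nat.le_zero, Set.ncard_eq_zero] at hcard
    have hmem : (⟨0, by omega⟩ : Fin (n + 1 - (n - m - 1))) ∈ freeIndices m n (n - m - 1) :=
      ⟨by simp only; omega, by simp only; omega⟩
    rw [hcard] at hmem
    exact hmem
  · intro h0
    refine ⟨isOrbit_iff.2 ⟨φ, rfl⟩, fun j hj _ O' hO' => ?_⟩
    obtain ⟨ψ, rfl⟩ := isOrbit_iff.1 hO'
    rw [zariskiDim_restrictTo_orbit hn hj h0]
    by_cases hψ0 : coords ψ 0 = 0
    · refine (zariskiDim_mono (restrictTo_orbit_subset hψ0)).trans ?_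
      rw [zariskiDim_graphSet]
      exact_mod_cast ncard_le_ncard_freeIndices m n j
    · rw [zariskiDim_restrictTo_orbit hn hj hψ0]

theorem orbit_eq_singleton_of_le (hn : n ≤ 2 * m + 2)
    (φ : Module.Dual f (Lq f (m + 1) (n + 1))) : orbit φ = {φ} :=
  orbit_eq_singleton fun j hj => by rw [lq_of_ge (by omega), map_zero]

theorem inGeneralPosition_of_le (hn : n ≤ 2 * m + 2)
    (φ : Module.Dual f (Lq f (m + 1) (n + 1))) :
    InGeneralPosition (m + 1) (n + 1) (orbit φ) := by
  refine ⟨isOrbit_iff.2 ⟨φ, rfl⟩, fun j _ _ O' hO' => ?_⟩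
  obtain ⟨ψ, rfl⟩ := isOrbit_iff.1 hO'
  rw [orbit_eq_singleton_of_le hn, orbit_eq_singleton_of_le hn, restrictTo, restrictTo,
    Set.image_singleton, Set.image_singleton, zariskiDim_singleton, zariskiDim_singleton]

end GeneralPosition

/-! ### Orbits that are affine planes -/

section Planes

variable {f : Type*} [Field f] {m n : ℕ}

/-- The coordinates of linear forms on `L_{M,n+1}` as a linear isomorphism. -/
def coordsEquiv (M n : ℕ) (hM : 1 ≤ M) :
    Module.Dual f (Lq f M (n + 1)) ≃ₗ[f] (Fin (n + 1 - M) → f) :=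
  LinearEquiv.ofBijective
    (M := Module.Dual f (Lq f M (n + 1))) (M₂ := Fin (n + 1 - M) → f)
    { toFun := fun φ r => coords φ r
      map_add' := fun _ _ => rfl
      map_smul' := fun _ _ => rfl }
    ⟨fun φ ψ h => dual_ext hM fun k hk => congrFun h ⟨k, by omega⟩, fun x => by
      obtain ⟨φ, hφ⟩ := exists_dual (M := M) (n := n)
        (fun k => if h : k < n + 1 - M then x ⟨k, h⟩ else 0)
      refine ⟨φ, funext fun r => ?_⟩
      have := hφ r (by omega)
      rw [dif_pos r.2] at this
      exact this⟩

theorem isAffinePlane_coords (hn : 2 * m < n) (φ : Module.Dual f (Lq f (m + 1) (n + 1))) :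
    IsAffinePlane f {ψ : Module.Dual f (Lq f (m + 1) (n + 1)) |
      ∀ k ≤ m, coords ψ k = coords φ k} (n - 2 * m - 1) := by
  let Λ : Module.Dual f (Lq f (m + 1) (n + 1)) →ₗ[f] (Fin (m + 1) → f) :=
    { toFun := fun φ r => coords φ r
      map_add' := fun _ _ => rfl
      map_smul' := fun _ _ => rfl }
  have hΛ : Function.Surjective Λ := fun x => by
    obtain ⟨φ, hφ⟩ := exists_dual (M := m + 1) (n := n)
      (fun k => if h : k < m + 1 then x ⟨k, h⟩ else 0)
    refine ⟨φ, funext fun r => ?_⟩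
    have := hφ r (by omega)
    rw [dif_pos r.2] at this
    exact this
  refine ⟨AffineSubspace.mk' φ (LinearMap.ker Λ), ?_, ⟨φ, fun _ _ => rfl⟩, ?_⟩
  · ext ψ
    rw [SetLike.mem_coe, AffineSubspace.mem_mk', vsub_eq_sub, LinearMap.mem_ker, map_sub,
      sub_eq_zero]
    exact ⟨fun h k hk => congrFun h ⟨k, by omega⟩, fun h => funext fun r => h r (by omega)⟩
  · rw [AffineSubspace.direction_mk']
    have : FiniteDimensional f (Module.Dual f (Lq f (m + 1) (n + 1))) :=
      (coordsEquiv (m + 1) n (by omega)).symm.finiteDimensional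
    have h := Λ.finrank_range_add_finrank_ker
    rw [LinearMap.range_eq_top.2 hΛ, finrank_top, (coordsEquiv (m + 1) n (by omega)).finrank_eq,
      Module.finrank_fin_fun, Module.finrank_fin_fun] at h
    omega

end Planes

/-! ### Descent to the level of the leading coordinate -/

section Levels

variable {f : Type*} [Field f] {M : ℕ}

theorem incl_lq {n i : ℕ} (h : n ≤ i) (φ : Module.Dual f (Lq f M n)) (j : ℕ) :
    incl M h φ (lq f M i j) = φ (lq f M n j) := by
  rcases le_or_gt M j with hj | hj
  · rw [lq_of_le _ hj, lq_of_le _ hj, incl_toLq]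
  · rw [lq_of_lt _ hj, lq_of_lt _ hj, map_zero, map_zero]

/-- A linear form with vanishing leading coordinate comes from the previous level. -/
theorem exists_incl_eq (hM : 1 ≤ M) {n : ℕ} {φ : Module.Dual f (Lq f M (n + 1 + 1))}
    (h0 : coords φ 0 = 0) :
    ∃ ψ : Module.Dual f (Lq f M (n + 1)), incl M (Nat.le_succ _) ψ = φ := by
  obtain ⟨ψ, hψ⟩ := exists_dual (M := M) (n := n) fun k => coords φ (k + 1)
  refine ⟨ψ, dual_ext hM fun k hk => ?_⟩
  rw [coords, incl_lq]
  rcases k with _ | k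
  · rw [lq_of_ge (by omega), map_zero, h0]
  · rw [← hψ k (by omega), coords]
    congr 2
    omega

/-- Descent as long as the leading coordinate vanishes. It stops at `2m + 2`, where every orbit is a
point and no condition is needed. -/
theorem exists_level {m i : ℕ} (hi : 2 * m + 2 ≤ i) (φ : Module.Dual f (Lq f (m + 1) (i + 1))) :
    ∃ (n : ℕ) (h : n ≤ i) (ψ : Module.Dual f (Lq f (m + 1) (n + 1))), 2 * m + 2 ≤ n ∧
      incl (m + 1) (Nat.succ_le_succ h) ψ = φ ∧ (2 * m + 2 < n → coords ψ 0 ≠ 0) := by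
  induction i, hi using Nat.le_induction with
  | base => exact ⟨_, le_rfl, φ, le_rfl, dual_ext_toLq fun D => rfl, fun h => absurd h (by omega)⟩
  | succ i hi ih =>
    by_cases h0 : coords φ 0 = 0
    · obtain ⟨χ, hχ⟩ := exists_incl_eq (by omega) h0
      obtain ⟨n, h, ψ, hn, hψ, hψ0⟩ := ih χ
      refine ⟨n, by omega, ψ, hn, ?_, hψ0⟩
      rw [← hχ, ← hψ]
      exact dual_ext_toLq fun D => by simp only [incl_toLq]
    · exact ⟨_, le_rfl, φ, by omega, dual_ext_toLq fun D => rfl, fun _ => h0⟩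

theorem inclStar_incl {n i : ℕ} (h : n ≤ i) (φ : Module.Dual f (Lq f M n)) :
    inclStar M i (incl M h φ) = inclStar M n φ := by
  refine Subtype.ext (LinearMap.ext fun D => ?_)
  rw [inclStar_apply, inclStar_apply, incl_toLq]

theorem exists_inclStar_eq (Φ : Lstar f M) (b : ℕ) :
    ∃ (i : ℕ) (φ : Module.Dual f (Lq f M (i + 1))), b ≤ i ∧ inclStar M (i + 1) φ = Φ := by
  obtain ⟨N, hN⟩ := Φ.2
  have hker : (LIdeal f M (max N b + 1)).toSubmodule ≤
      LinearMap.ker (Φ : Module.Dual f (L f M)) := fun D hD =>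
    hN D (L_antitone (by omega) hD)
  refine ⟨max N b, (LIdeal f M (max N b + 1)).toSubmodule.liftQ _ hker, by omega, ?_⟩
  exact Subtype.ext (LinearMap.ext fun D => rfl)

end Levels

/-! ### Parametrization of the orbits in general position -/

section Main

variable {f : Type*} [Field f] [CharZero f] {m n : ℕ}

theorem exists_inGeneralPosition_level {i : ℕ} (hi : 2 * m + 2 ≤ i)
    (φ : Module.Dual f (Lq f (m + 1) (i + 1))) :
    ∃ (n : ℕ) (h : n ≤ i) (ψ : Module.Dual f (Lq f (m + 1) (n + 1))), 2 * m + 2 ≤ n ∧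
      incl (m + 1) (Nat.succ_le_succ h) ψ = φ ∧ InGeneralPosition (m + 1) (n + 1) (orbit ψ) := by
  obtain ⟨n, h, ψ, hn, hψ, hψ0⟩ := exists_level hi φ
  refine ⟨n, h, ψ, hn, hψ, ?_⟩
  rcases hn.eq_or_lt with hn | hn
  · exact inGeneralPosition_of_le hn.ge ψ
  · exact (inGeneralPosition_iff hn).2 (hψ0 hn)

/-- In `aeval_P` the truncated term depends only on `x_0, …, x_m`, so it is the same for both forms,
and the powers of `x_0` cancel. -/
theorem aeval_P_eq_iff {φ ψ : Module.Dual f (Lq f (m + 1) (n + 1))}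
    (h : ∀ k ≤ m, coords ψ k = coords φ k) (h0 : coords φ 0 ≠ 0) {p : ℕ} (hp : m ≤ p) :
    MvPolynomial.aeval (coords ψ) (P f m (p - m)) = MvPolynomial.aeval (coords φ) (P f m (p - m)) ↔
      sqrtCoeff (coords ψ) p = sqrtCoeff (coords φ) p := by
  have hψ0 := h 0 (Nat.zero_le m)
  have h1 := aeval_P (coords ψ) (by rwa [hψ0]) m (p - m)
  have h2 := aeval_P (coords φ) h0 m (p - m)
  have hc : (fun i => if i ≤ m then coords ψ i else 0) =
      fun i => if i ≤ m then coords φ i else 0 := by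
    funext i
    split_ifs with hi
    · exact h i hi
    · rfl
  rw [hc, hψ0, Nat.add_sub_cancel' hp] at h1
  rw [Nat.add_sub_cancel' hp] at h2
  constructor
  · intro e
    rw [e, h2] at h1
    have := mul_left_cancel₀ (pow_ne_zero p h0) h1
    linear_combination -this
  · intro e
    rw [e, ← h2] at h1
    exact mul_left_cancel₀ (pow_ne_zero m h0) h1

theorem exists_dual_aeval_P (hn : 2 * m + 2 < n) {p : ℕ} (hp : n = 2 * p) (x : ℕ → f)
    (h0 : x 0 ≠ 0) (c : f) :
    ∃ ψ : Module.Dual f (Lq f (m + 1) (n + 1)), (∀ k ≤ m, coords ψ k = x k) ∧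
      MvPolynomial.aeval (coords ψ) (P f m (p - m)) = c := by
  -- The prescribed invariant is the solution of the identity `aeval_P` with `P = c`.
  obtain ⟨ψ, h1, h2⟩ := exists_dual_sqrtCoeff hn x h0
    (c * x 0 ^ m / x 0 ^ p + sqrtCoeff (fun i => if i ≤ m then x i else 0) p)
  have h1' : ∀ k ≤ m, coords ψ k = x k := fun k hk => h1 k (by omega) (by omega)
  refine ⟨ψ, h1', ?_⟩
  have hψ0 := h1' 0 (Nat.zero_le m)
  have h := aeval_P (coords ψ) (by rwa [hψ0]) m (p - m)
  have hc : (fun i => if i ≤ m then coords ψ i else 0) = fun i => if i ≤ m then x i else 0 := by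
    funext i
    split_ifs with hi
    · exact h1' i hi
    · rfl
  rw [Nat.add_sub_cancel' (by omega), hc, hψ0, h2 p hp, add_sub_cancel_right,
    mul_div_cancel₀ _ (pow_ne_zero p h0), mul_comm c] at h
  exact mul_left_cancel₀ (pow_ne_zero m h0) h

theorem orbit_of_odd (hn : 2 * m + 2 < n) (ho : Odd n)
    {φ : Module.Dual f (Lq f (m + 1) (n + 1))} (h0 : coords φ 0 ≠ 0) :
    orbit φ = {ψ | ∀ k ≤ m, coords ψ k = coords φ k} := by
  obtain ⟨q, hq⟩ := ho
  ext ψ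
  rw [mem_orbit_iff hn h0]
  exact ⟨fun h => h.1, fun h => ⟨h, fun p hp => by omega⟩⟩

theorem orbit_of_even (hn : 2 * m + 2 < n) {p : ℕ} (hp : n = 2 * p)
    {φ : Module.Dual f (Lq f (m + 1) (n + 1))} (h0 : coords φ 0 ≠ 0) :
    orbit φ = {ψ | (∀ k ≤ m, coords ψ k = coords φ k) ∧
      MvPolynomial.aeval (coords ψ) (P f m (p - m)) =
        MvPolynomial.aeval (coords φ) (P f m (p - m))} := by
  ext ψ
  rw [mem_orbit_iff hn h0]
  refine and_congr_right fun h => ?_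
  rw [aeval_P_eq_iff h h0 (by omega)]
  exact ⟨fun h => h p hp, fun h q hq => by rwa [show q = p by omega]⟩

theorem bijOn_of_odd (hn : 2 * m + 2 < n) (ho : Odd n) :
    Set.BijOn
      (fun c : Fin (m + 1) → f => {φ : Module.Dual f (Lq f (m + 1) (n + 1)) |
        ∀ r : Fin (m + 1), coords φ r = c r})
      {c | c 0 ≠ 0} {O | InGeneralPosition (m + 1) (n + 1) O} := by
  have hex : ∀ c : Fin (m + 1) → f, ∃ φ : Module.Dual f (Lq f (m + 1) (n + 1)),
      ∀ r : Fin (m + 1), coords φ r = c r := fun c => by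
    obtain ⟨φ, hφ⟩ := exists_dual (M := m + 1) (n := n)
      fun k => if h : k < m + 1 then c ⟨k, h⟩ else 0
    exact ⟨φ, fun r => by rw [hφ r (by omega), dif_pos r.2]⟩
  have horb : ∀ φ : Module.Dual f (Lq f (m + 1) (n + 1)), coords φ 0 ≠ 0 →
      ∀ c : Fin (m + 1) → f, (∀ r : Fin (m + 1), coords φ r = c r) →
      {ψ : Module.Dual f (Lq f (m + 1) (n + 1)) | ∀ r : Fin (m + 1), coords ψ r = c r} =
        orbit φ := fun φ h0 c hc => by
    rw [orbit_of_odd hn ho h0]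
    ext ψ
    exact ⟨fun h k hk => (h ⟨k, by omega⟩).trans (hc ⟨k, by omega⟩).symm,
      fun h r => (h r (by omega)).trans (hc r)⟩
  refine ⟨fun c hc => ?_, fun c _ c' _ h => ?_, fun O hO => ?_⟩
  · obtain ⟨φ, hφ⟩ := hex c
    have h0 : coords φ 0 ≠ 0 := by
      rw [show coords φ 0 = c 0 from hφ 0]
      exact hc
    change InGeneralPosition _ _ {ψ | _}
    rw [horb φ h0 c hφ]
    exact (inGeneralPosition_iff hn).2 h0
  · obtain ⟨φ, hφ⟩ := hex c
    have hφ' : ∀ r : Fin (m + 1), coords φ r = c' r := (Set.ext_iff.1 h φ).1 hφ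
    exact funext fun r => (hφ r).symm.trans (hφ' r)
  · obtain ⟨φ, rfl⟩ := isOrbit_iff.1 hO.1
    have h0 := (inGeneralPosition_iff hn).1 hO
    exact ⟨fun r => coords φ r, h0, horb φ h0 _ fun _ => rfl⟩

theorem bijOn_of_even (hn : 2 * m + 2 < n) {p : ℕ} (hp : n = 2 * p) :
    Set.BijOn
      (fun c : Fin (m + 2) → f => {φ : Module.Dual f (Lq f (m + 1) (n + 1)) |
        (∀ r : Fin (m + 1), coords φ r = c r.castSucc) ∧
          MvPolynomial.aeval (coords φ) (P f m (p - m)) = c (Fin.last (m + 1))})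
      {c | c 0 ≠ 0} {O | InGeneralPosition (m + 1) (n + 1) O} := by
  have hex : ∀ c : Fin (m + 2) → f, c 0 ≠ 0 → ∃ φ : Module.Dual f (Lq f (m + 1) (n + 1)),
      (∀ r : Fin (m + 1), coords φ r = c r.castSucc) ∧
        MvPolynomial.aeval (coords φ) (P f m (p - m)) = c (Fin.last (m + 1)) := fun c hc => by
    obtain ⟨φ, hφ, hφP⟩ := exists_dual_aeval_P hn hp
      (fun k => if h : k < m + 1 then c (Fin.castSucc ⟨k, h⟩) else 0)
      (by rw [dif_pos (Nat.succ_pos m)]; exact hc) (c (Fin.last (m + 1)))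
    exact ⟨φ, fun r => by rw [hφ r (by omega), dif_pos r.2], hφP⟩
  have horb : ∀ φ : Module.Dual f (Lq f (m + 1) (n + 1)), coords φ 0 ≠ 0 →
      ∀ c : Fin (m + 2) → f, (∀ r : Fin (m + 1), coords φ r = c r.castSucc) →
      MvPolynomial.aeval (coords φ) (P f m (p - m)) = c (Fin.last (m + 1)) →
      {ψ : Module.Dual f (Lq f (m + 1) (n + 1)) |
        (∀ r : Fin (m + 1), coords ψ r = c r.castSucc) ∧
          MvPolynomial.aeval (coords ψ) (P f m (p - m)) = c (Fin.last (m + 1))} =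
        orbit φ := fun φ h0 c hc hP => by
    rw [orbit_of_even hn hp h0, hP]
    ext ψ
    exact and_congr_left fun _ =>
      ⟨fun h k hk => (h ⟨k, by omega⟩).trans (hc ⟨k, by omega⟩).symm,
        fun h r => (h r (by omega)).trans (hc r)⟩
  refine ⟨fun c hc => ?_, fun c hc c' _ h => ?_, fun O hO => ?_⟩
  · obtain ⟨φ, hφ, hφP⟩ := hex c hc
    have h0 : coords φ 0 ≠ 0 := by
      rw [show coords φ 0 = c 0 from hφ 0]
      exact hc
    change InGeneralPosition _ _ {ψ | _}
    rw [horb φ h0 c hφ hφP]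
    exact (inGeneralPosition_iff hn).2 h0
  · obtain ⟨φ, hφ⟩ := hex c hc
    have hφ' := (Set.ext_iff.1 h φ).1 hφ
    refine funext fun r => ?_
    induction r using Fin.lastCases with
    | last => exact hφ.2.symm.trans hφ'.2
    | cast r => exact (hφ.1 r).symm.trans (hφ'.1 r)
  · obtain ⟨φ, rfl⟩ := isOrbit_iff.1 hO.1
    have h0 := (inGeneralPosition_iff hn).1 hO
    refine ⟨Fin.snoc (fun r => coords φ r) (MvPolynomial.aeval (coords φ) (P f m (p - m))), ?_,
      horb φ h0 _ (fun r => ?_) ?_⟩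
    · change Fin.snoc (α := fun _ => f) _ _ (Fin.castSucc 0) ≠ 0
      rw [Fin.snoc_castSucc]
      exact h0
    · rw [Fin.snoc_castSucc]
    · rw [Fin.snoc_last]

end Main

end FormalLine
end

theorem theorem2 {f : Type*} [Field f] [CharZero f] (m : ℕ) :
    -- the orbits of `G_{m+1,n+1}` in `L_{m+1,n+1}^*` for `n ≤ 2m + 2`
    (∀ n : ℕ, m ≤ n → n ≤ 2 * m + 2 →
      (∀ O : Set (Module.Dual f (Lq f (m + 1) (n + 1))),
        IsOrbit (coad f (m + 1) (n + 1)) O ↔ ∃ φ, O = {φ}) ∧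
      (∀ O : Set (Module.Dual f (Lq f (m + 1) (n + 1))),
        IsOrbit (coad f (m + 1) (n + 1)) O → InGeneralPosition (m + 1) (n + 1) O)) ∧
    -- the orbits in general position for odd `n > 2m + 2`
    (∀ n : ℕ, 2 * m + 2 < n → Odd n →
      Set.BijOn
        (fun c : Fin (m + 1) → f =>
          {φ : Module.Dual f (Lq f (m + 1) (n + 1)) |
            ∀ r : Fin (m + 1), φ (lq f (m + 1) (n + 1) (n - r)) = c r})
        {c | c 0 ≠ 0}
        {O | InGeneralPosition (m + 1) (n + 1) O} ∧
      (∀ O : Set (Module.Dual f (Lq f (m + 1) (n + 1))),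
        InGeneralPosition (m + 1) (n + 1) O → IsAffinePlane f O (n - 2 * m - 1))) ∧
    -- the orbits in general position for even `n > 2m + 2`
    (∀ n : ℕ, 2 * m + 2 < n → Even n →
      Set.BijOn
        (fun c : Fin (m + 2) → f =>
          {φ : Module.Dual f (Lq f (m + 1) (n + 1)) |
            (∀ r : Fin (m + 1), φ (lq f (m + 1) (n + 1) (n - r)) = c r.castSucc) ∧
            MvPolynomial.aeval (fun r : ℕ => φ (lq f (m + 1) (n + 1) (n - r)))
              (P f m (n / 2 - m)) = c (Fin.last (m + 1))})
        {c | c 0 ≠ 0}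
        {O | InGeneralPosition (m + 1) (n + 1) O} ∧
      (∀ O : Set (Module.Dual f (Lq f (m + 1) (n + 1))),
        InGeneralPosition (m + 1) (n + 1) O →
          IsAffineVariety (restrictTo (m + 1) O) (n - 2 * m - 2))) ∧
    -- an orbit in general position remains an orbit at all higher levels and in `L_{m+1}^*`
    (∀ n : ℕ, m ≤ n → ∀ O : Set (Module.Dual f (Lq f (m + 1) (n + 1))),
      InGeneralPosition (m + 1) (n + 1) O →
        (∀ (i : ℕ) (h : n ≤ i),
          IsOrbit (coad f (m + 1) (i + 1)) (incl (m + 1) (Nat.succ_le_succ h) '' O)) ∧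
        IsOrbit (coadStar f (m + 1)) (inclStar (m + 1) (n + 1) '' O)) ∧
    -- every orbit in `L_{m+1,i+1}^*` is an orbit in general position at some level
    (∀ i : ℕ, m ≤ i → ∀ O : Set (Module.Dual f (Lq f (m + 1) (i + 1))),
      IsOrbit (coad f (m + 1) (i + 1)) O →
        ∃ (n : ℕ) (h : n ≤ i), min (2 * m + 2) i ≤ n ∧
          ∃ O' : Set (Module.Dual f (Lq f (m + 1) (n + 1))),
            InGeneralPosition (m + 1) (n + 1) O' ∧
              O = incl (m + 1) (Nat.succ_le_succ h) '' O') ∧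
    -- every orbit in `L_{m+1}^*` is an orbit in general position at some level
    (∀ O : Set (Lstar f (m + 1)), IsOrbit (coadStar f (m + 1)) O →
      ∃ n : ℕ, 2 * m + 2 ≤ n ∧
        ∃ O' : Set (Module.Dual f (Lq f (m + 1) (n + 1))),
          InGeneralPosition (m + 1) (n + 1) O' ∧ O = inclStar (m + 1) (n + 1) '' O') := by
  refine ⟨fun n _ hn => ⟨fun O => ?_, fun O hO => ?_⟩,
    fun n hn ho => ⟨bijOn_of_odd hn ho, fun O hO => ?_⟩, fun n hn he => ⟨?_, fun O hO => ?_⟩,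
    fun n _ O hO => ?_, fun i hi O hO => ?_, fun O hO => ?_⟩
  · rw [isOrbit_iff]
    simp only [orbit_eq_singleton_of_le hn]
  · obtain ⟨φ, rfl⟩ := isOrbit_iff.1 hO
    exact inGeneralPosition_of_le hn φ
  · obtain ⟨φ, rfl⟩ := isOrbit_iff.1 hO.1
    rw [orbit_of_odd hn ho ((inGeneralPosition_iff hn).1 hO)]
    exact isAffinePlane_coords (by omega) φ
  · obtain ⟨p, hp⟩ := even_iff_exists_two_mul.1 he
    have := bijOn_of_even (f := f) hn hp
    rw [show p = n / 2 by omega] at this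
    exact this
  · obtain ⟨φ, rfl⟩ := isOrbit_iff.1 hO.1
    rw [restrictTo_orbit hn le_rfl ((inGeneralPosition_iff hn).1 hO),
      ← ncard_freeIndices_even hn he]
    exact isAffineVariety_graphSet _ _
  · obtain ⟨φ, rfl⟩ := isOrbit_iff.1 hO.1
    exact ⟨fun i h => isOrbit_iff.2 ⟨_, image_incl_orbit _ φ⟩, _, image_inclStar_orbit φ⟩
  · obtain ⟨φ, rfl⟩ := isOrbit_iff.1 hO
    -- Up to level `2m + 2` the orbit is already in general position, with `n = i`; above it the
    -- descent applies. This is the source of the minimum.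
    rcases le_total i (2 * m + 2) with h | h
    · refine ⟨i, le_rfl, min_le_right _ _, orbit φ, inGeneralPosition_of_le h φ, ?_⟩
      rw [image_incl_orbit]
      congr 1
      exact dual_ext_toLq fun D => rfl
    · obtain ⟨n, hni, ψ, hn, rfl, hgp⟩ := exists_inGeneralPosition_level h φ
      exact ⟨n, hni, (min_le_left _ _).trans hn, orbit ψ, hgp, (image_incl_orbit _ ψ).symm⟩
  · obtain ⟨Φ, rfl⟩ := hO
    obtain ⟨i, φ, hi, rfl⟩ := exists_inclStar_eq Φ (2 * m + 2)
    obtain ⟨n, hni, ψ, hn, rfl, hgp⟩ := exists_inGeneralPosition_level hi φ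
    exact ⟨n, hn, orbit ψ, hgp, by rw [inclStar_incl, image_inclStar_orbit]⟩
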